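/- Let $\mathcal K$ be a generalized Ford configuration: a finite collection of circles on $\widehat{\mathbb C}=\mathbb C\cup\{\infty\}$ consisting of the two lines $C_0=\mathbb R$ and $\mathbb R+\mathrm i$, the circles of radius $\tfrac12$ centred at $\tfrac{\mathrm i}2$ and $\tfrac t2+\tfrac{\mathrm i}2$ (for some $t\ge 2$), and possibly finitely many further circles of the strip $0\le \operatorname{Im} z\le 1$ lying between these two. The closed disks bounded by these circles (with the half planes $\operatorname{Im} z\le 0$ and $\operatorname{Im} z\ge 1$ for the two lines) have disjoint interiors, and every gap, that is, every connected component of the complement of the union of the disks, is a curvilinear triangle bounded by three mutually tangent circles of $\mathcal K$. Let $\mathcal S$ be the set of reflections in the dual circles of the gaps, where the dual circle of a gap is the circle or line through the three vertices of the gap. Let $\mathfrak S=\langle\mathcal S\rangle$ and let $\mathcal P=\mathfrak S\,\mathcal K$ be the resulting circle packing. Let $\mathcal P_0$ be the set of circles of $\mathcal P$ tangent to $C_0$, let $\mathcal K_0=\mathcal K\cap\mathcal P_0$, and let $\Gamma_0=\{\gamma\in\mathfrak S:\gamma(C_0)=C_0\}$. For real $T$ let $\mathcal A_T\subset\mathbb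 R$ be the set of points at which circles of $\mathcal P_0$ of curvature at most $T$ touch $C_0$ (a circle of radius $r$ has curvature $1/r$, a line has curvature $0$). Let $\alpha_1',\alpha_2'$ be adjacent points of $\mathcal A_T$, that is, distinct points of $\mathcal A_T$ with no point of $\mathcal A_T$ strictly between them, and let $C_1',C_2'\in\mathcal P_0$ be the corresponding circles. Then there are $\gamma\in\Gamma_0$ and $C_i,C_j\in\mathcal K_0$ such that $\gamma(C_i)=C_1'$ and $\gamma(C_j)=C_2'$. Moreover, consider the set $E$ of all $\gamma'\in\Gamma_0$ such that $\gamma'(A)=C_1'$ and $\gamma'(B)=C_2'$ for some $A,B\in\mathcal K_0$. 1. If $C_1'$ and $C_2'$ are disjoint, then $E=\{\gamma\}$. 2. If $C_1'$ and $C_2'$ are tangent and $C_i$, $C_j$, $\mathbb R$ bound a triangular gap, then $E=\{\gamma,\gamma S_{i,j}\}$ and $\gamma S_{i,j}\neq\gamma$, where $S_{i,j}\in\mathcal S$ is the reflection in the dual circle of that gap. 3. If $C_1'$ and $C_2'$ are tangent but $C_i$, $C_j$, $\mathbb R$ do not bound a gap (so that there is no such generator $S_{i,j}$), then $E=\{\gamma\}$.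 -/

import Mathlib

open scoped Pointwise

noncomputable section

namespace FordPacking

/-- The Riemann sphere `ℂ ∪ {∞}`. -/
abbrev RSphere : Type := OnePoint ℂ

/-! ### Circles on the sphere and reflections in them -/

/-- The Euclidean circle with centre `c` and radius `r`. -/
def euclCircle (c : ℂ) (r : ℝ) : Set RSphere :=
  (fun z : ℂ => (z : RSphere)) '' Metric.sphere c r

/-- The line `a + ℝ u`, completed by the point `∞`. -/
def line (a u : ℂ) : Set RSphere :=
  insert OnePoint.infty ((fun s : ℝ => ((a + s * u : ℂ) : RSphere)) '' Set.univ)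

/-- The completed real line, which is the base circle `C₀`. -/
def realLine : Set RSphere := line 0 1

/-- The completed horizontal line `ℝ + i`. -/
def topLine : Set RSphere := line Complex.I 1

open Classical in
/-- Inversion in the circle with centre `c` and radius `r`, extended to the sphere: it exchanges
`c` and `∞`. -/
def inversion (c : ℂ) (r : ℝ) (z : RSphere) : RSphere :=
  z.elim (c : RSphere)
    (fun w : ℂ =>
      if w = c then OnePoint.infty
      else ((c + (r : ℂ) ^ 2 / (starRingEnd ℂ) (w - c) : ℂ) : RSphere))

/-- Euclidean reflection in the line `a + ℝ u`, fixing `∞`. -/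
def lineReflection (a u : ℂ) (z : RSphere) : RSphere :=
  z.elim OnePoint.infty
    (fun w : ℂ => ((a + u * (starRingEnd ℂ) ((w - a) / u) : ℂ) : RSphere))

/-- `S` is the reflection in the circle (or completed line) `D`. -/
def IsReflectionIn (D : Set RSphere) (S : Equiv.Perm RSphere) : Prop :=
  (∃ (c : ℂ) (r : ℝ), 0 < r ∧ D = euclCircle c r ∧ ∀ z, S z = inversion c r z) ∨
  (∃ a u : ℂ, u ≠ 0 ∧ D = line a u ∧ ∀ z, S z = lineReflection a u z)

/-- `κ` is the curvature of the circle `C`: `1 / r` for a Euclidean circle of radius `r`, and `0`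
for a line. -/
def HasCurvature (C : Set RSphere) (κ : ℝ) : Prop :=
  (∃ (c : ℂ) (r : ℝ), 0 < r ∧ C = euclCircle c r ∧ κ = 1 / r) ∨
  (∃ a u : ℂ, u ≠ 0 ∧ C = line a u ∧ κ = 0)

/-- Two circles on the sphere are tangent when they meet in exactly one point. -/
def Tangent (A B : Set RSphere) : Prop := ∃ p, A ∩ B = {p}

/-! ### Generalized Ford configurations -/

/-- The two lines `ℝ`, `ℝ + i` together with the circles whose centres and radii are listed in
`disks`. -/
def circlesOf (disks : Finset (ℂ × ℝ)) : Set (Set RSphere) :=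
  {realLine, topLine} ∪ {C | ∃ p ∈ disks, C = euclCircle p.1 p.2}

/-- The complement of the closed disks of the configuration; the disks bounded by `ℝ` and `ℝ + i`
are the closed half planes `Im z ≤ 0` and `Im z ≥ 1` (both containing `∞`). -/
def gapRegion (disks : Finset (ℂ × ℝ)) : Set ℂ :=
  {z | 0 < z.im ∧ z.im < 1 ∧ ∀ p ∈ disks, p.2 < dist z p.1}

/-- The gap containing the point `z`, that is, the connected component of the complement of the
closed disks that contains `z`, is a curvilinear triangle bounded by the circles `A`, `B`, `C`:
these are mutually tangent, and the gap is a connected component of the complement of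
`A ∪ B ∪ C`. -/
def IsTriangularGap (disks : Finset (ℂ × ℝ)) (z : ℂ) (A B C : Set RSphere) : Prop :=
  z ∈ gapRegion disks ∧ A ∈ circlesOf disks ∧ B ∈ circlesOf disks ∧ C ∈ circlesOf disks ∧
  Tangent A B ∧ Tangent B C ∧ Tangent A C ∧
  connectedComponentIn (gapRegion disks) z =
    connectedComponentIn {w : ℂ | (w : RSphere) ∉ A ∪ B ∪ C} z

/-- A generalized Ford configuration: a finite packing by circles with disjoint interiors, all of
whose gaps are curvilinear triangles, that consists of `ℝ`, `ℝ + i`, the circles of radius `1/2`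
centred at `i/2` and `t/2 + i/2` (which touch both lines), and possibly other circles of the strip
between these two. -/
structure FordConfiguration where
  t : ℝ
  two_le_t : 2 ≤ t
  /-- centres and radii of the circles other than the two lines -/
  disks : Finset (ℂ × ℝ)
  radius_pos : ∀ p ∈ disks, 0 < p.2
  in_strip : ∀ p ∈ disks, p.2 ≤ p.1.im ∧ p.1.im + p.2 ≤ 1
  first_mem : ((Complex.I / 2 : ℂ), (1 / 2 : ℝ)) ∈ disks
  last_mem : (((t : ℂ) / 2 + Complex.I / 2 : ℂ), (1 / 2 : ℝ)) ∈ disks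
  between : ∀ p ∈ disks, 0 ≤ p.1.re ∧ p.1.re ≤ t / 2
  disjoint_interiors : ∀ p ∈ disks, ∀ q ∈ disks, p ≠ q → p.2 + q.2 ≤ dist p.1 q.1
  triangular_gaps : ∀ z ∈ gapRegion disks, ∃ A B C, IsTriangularGap disks z A B C

namespace FordConfiguration

variable (F : FordConfiguration)

/-- The initial configuration `𝒦`. -/
def initial : Set (Set RSphere) := circlesOf F.disks

/-- `S` is the reflection in the dual circle of a triangular gap bounded by `A`, `B`, `C`, that is,
in the circle through the three points where `A`, `B`, `C` touch each other. -/
def IsGapReflection (A B C : Set RSphere) (S : Equiv.Perm RSphere) : Prop :=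
  (∃ z, IsTriangularGap F.disks z A B C) ∧
  ∃ D, IsReflectionIn D S ∧ A ∩ B ⊆ D ∧ B ∩ C ⊆ D ∧ A ∩ C ⊆ D

/-- The set `𝒮` of reflections in the dual circles of all the triangular gaps. -/
def gapReflections : Set (Equiv.Perm RSphere) := {S | ∃ A B C, F.IsGapReflection A B C S}

/-- The group `𝔖` generated by the reflections in the dual circles. -/
def reflectionGroup : Subgroup (Equiv.Perm RSphere) := Subgroup.closure F.gapReflections

/-- The packing `𝒫`: all images of circles of the initial configuration under `𝔖`. -/
def packing : Set (Set RSphere) := {C | ∃ g ∈ F.reflectionGroup, ∃ A ∈ F.initial, C = g • A}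

/-- `𝒫₀`: the circles of the packing that are tangent to `C₀ = ℝ`. -/
def packing₀ : Set (Set RSphere) := {C | C ∈ F.packing ∧ Tangent C realLine}

/-- `𝒦₀ = 𝒦 ∩ 𝒫₀`. -/
def initial₀ : Set (Set RSphere) := F.initial ∩ F.packing₀

/-- `Γ₀`: the elements of `𝔖` that fix the circle `C₀ = ℝ` (as a set). -/
def Gamma₀ : Subgroup (Equiv.Perm RSphere) :=
  F.reflectionGroup ⊓ MulAction.stabilizer (Equiv.Perm RSphere) realLine

/-- `C` is a circle of `𝒫₀` of curvature at most `T` that touches `ℝ` at the point `x`. -/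
def TouchesAt (T x : ℝ) (C : Set RSphere) : Prop :=
  C ∈ F.packing₀ ∧ C ∩ realLine = {(((x : ℝ) : ℂ) : RSphere)} ∧ ∃ κ, HasCurvature C κ ∧ κ ≤ T

/-- `𝒜_T`: the tangencies on `ℝ` of the circles of `𝒫₀` of curvature at most `T`. -/
def tangencies (T : ℝ) : Set ℝ := {x | ∃ C, F.TouchesAt T x C}

/-- The elements `γ` of `Γ₀` for which there are circles `A`, `B` of `𝒦₀` with `γ(A) = C₁` and
`γ(B) = C₂`. -/
def carriers (C₁ C₂ : Set RSphere) : Set (Equiv.Perm RSphere) :=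
  {γ | γ ∈ F.Gamma₀ ∧ ∃ A ∈ F.initial₀, ∃ B ∈ F.initial₀, γ • A = C₁ ∧ γ • B = C₂}

end FordConfiguration

/-- `x` and `y` are distinct points of `A` with no point of `A` strictly between them. -/
def AdjacentIn (A : Set ℝ) (x y : ℝ) : Prop :=
  x ∈ A ∧ y ∈ A ∧ x ≠ y ∧ ∀ z ∈ A, ¬ (min x y < z ∧ z < max x y)

end FordPacking

end

/-!
Everything takes place in inversive coordinates: an oriented circle on the sphere is a unit vector
of a four-dimensional space with the Lorentzian form `ip`, reflection in a circle is a linear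
hyperplane reflection (`smul_circ_of_lift`), and the disks of two circles have disjoint interiors
when the product is at most `-1`, with equality for tangent circles. Three mutually tangent circles
and their dual circle form a basis, and `IsDual.ip_eq` gives the form in it.

*Mirrors.* The dual circle of a gap is oriented towards the gap. The part of the dual disk outside
three mutually tangent circles is connected, so a gap is all of it, and every circle of the
configuration other than the three lies outside the dual circle, with product at most `-2`
(`IsGapReflection.exists_mirror`). The interstice on the unbounded side of a dual circle cannot be a
gap because it leaves the strip, so dual circles have nonnegative curvature. By `IsDual.ip_eq`,
different dual circles have product at most `-1` (`IsMirrorOf.ip_le`).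

*Ping-pong.* The reflections therefore play ping-pong: a reduced word either fixes a circle of the
configuration letter by letter or moves it into the mirror of its first letter
(`MirrorSystem.pingpong`). Hence every circle of the packing that touches `ℝ` is the image of an
initial circle under reflections in mirrors orthogonal to `ℝ` (`exists_word_of_mem_packing₀`), and
two such circles either lie in one image of the initial configuration or are separated by an image
of a mirror orthogonal to `ℝ` (`MirrorSystem.common_image_or_separated`).

*Existence.* Suppose such an image separates circles touching `ℝ` at adjacent points. At its two
ends it has tangent circles `A`, `B` of the packing. One of the two given circles touches `ℝ`
inside the mirror (if the mirror is a line, either side will do), and its curvature is then at least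
the sum of those of `A` and `B` (`curvature_add_le`), so both of these have curvature at most `T`.
But one of them touches `ℝ` strictly between the two points, which contradicts adjacency
(`not_separated`).

*Uniqueness.* Two carrying elements differ by an element that maps two initial circles, and `ℝ`, to
initial circles. Every letter of its reduced word fixes all three, so it is orthogonal to three
circles, which leaves one possible letter (`eq_one_or_mirror`).
-/

noncomputable section

namespace FordPacking

/-! ### Inversive coordinates -/

/-- Inversive coordinates. The vector `v` stands for the generalized circle
`v 0 * |z|² - 2 * (v 1 * re z + v 2 * im z) + v 3 = 0`, so that `v 0` is the signed curvature of a
unit vector for the Lorentzian form `ip`. Opposite vectors stand for the two sides of one circle. -/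
abbrev CircleVec : Type := Fin 4 → ℝ

/-- The Lorentzian inner product of inversive coordinates. Unit vectors are oriented circles, and
two circles with disjoint interiors have product at most `-1`, with equality when they touch. -/
def ip (v w : CircleVec) : ℝ := v 1 * w 1 + v 2 * w 2 - (v 0 * w 3 + v 3 * w 0) / 2

lemma ip_comm (v w : CircleVec) : ip v w = ip w v := by simp only [ip]; ring

lemma ip_add_left (u v w : CircleVec) : ip (u + v) w = ip u w + ip v w := by
  simp only [ip, Pi.add_apply]; ring

lemma ip_sub_left (u v w : CircleVec) : ip (u - v) w = ip u w - ip v w := by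
  simp only [ip, Pi.sub_apply]; ring

lemma ip_smul_left (s : ℝ) (v w : CircleVec) : ip (s • v) w = s * ip v w := by
  simp only [ip, Pi.smul_apply, smul_eq_mul]; ring

lemma ip_smul_right (s : ℝ) (v w : CircleVec) : ip v (s • w) = s * ip v w := by
  simp only [ip, Pi.smul_apply, smul_eq_mul]; ring

lemma ip_neg_left (v w : CircleVec) : ip (-v) w = -ip v w := by
  simp only [ip, Pi.neg_apply]; ring

lemma ip_neg_right (v w : CircleVec) : ip v (-w) = -ip v w := by
  simp only [ip, Pi.neg_apply]; ring

/-- The form is nondegenerate. -/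
lemma eq_of_forall_ip_eq {v w : CircleVec} (h : ∀ u, ip u v = ip u w) : v = w := by
  have h0 := h ![1, 0, 0, 0]
  have h1 := h ![0, 1, 0, 0]
  have h2 := h ![0, 0, 1, 0]
  have h3 := h ![0, 0, 0, 1]
  simp [ip] at h0 h1 h2 h3
  funext i
  fin_cases i <;> simp <;> linarith

/-- The reflection in the hyperplane orthogonal to the unit vector `D`: inversion in the circle
`D`, in inversive coordinates. -/
def refl (D v : CircleVec) : CircleVec := v - (2 * ip v D) • D

lemma ip_refl_left (D v w : CircleVec) :
    ip (refl D v) w = ip v w - 2 * ip v D * ip D w := by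
  rw [refl, ip_sub_left, ip_smul_left]

lemma ip_refl_comm (D v w : CircleVec) : ip (refl D v) w = ip v (refl D w) := by
  rw [ip_refl_left, ip_comm v (refl D w), ip_refl_left, ip_comm w v, ip_comm w D, ip_comm v D]
  ring

lemma refl_refl {D : CircleVec} (hD : ip D D = 1) (v : CircleVec) : refl D (refl D v) = v := by
  rw [refl, ip_refl_left, hD, refl, sub_sub, ← add_smul]
  have : 2 * ip v D + 2 * (ip v D - 2 * ip v D * 1) = 0 := by ring
  rw [this, zero_smul, sub_zero]

lemma ip_refl_refl {D : CircleVec} (hD : ip D D = 1) (v w : CircleVec) :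
    ip (refl D v) (refl D w) = ip v w := by
  rw [ip_refl_comm, refl_refl hD]

lemma refl_neg (D v : CircleVec) : refl (-D) v = refl D v := by
  simp [refl, ip_neg_right]

lemma refl_eq_self {D v : CircleVec} (h : ip v D = 0) : refl D v = v := by
  simp [refl, h]

/-- `D` is the unit vector of a dual circle of three mutually tangent circles `A`, `B`, `C`. -/
structure IsDual (D A B C : CircleVec) : Prop where
  aa : ip A A = 1
  bb : ip B B = 1
  cc : ip C C = 1
  ab : ip A B = -1
  bc : ip B C = -1
  ac : ip A C = -1
  dd : ip D D = 1
  da : ip D A = 0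
  db : ip D B = 0
  dc : ip D C = 0

lemma IsDual.neg {D A B C : CircleVec} (h : IsDual D A B C) : IsDual (-D) A B C :=
  { h with
    dd := by rw [ip_neg_left, ip_neg_right, neg_neg, h.dd]
    da := by rw [ip_neg_left, h.da, neg_zero]
    db := by rw [ip_neg_left, h.db, neg_zero]
    dc := by rw [ip_neg_left, h.dc, neg_zero] }

/-- Three mutually tangent circles and their dual circle form a basis; this is the inner product
in terms of the products with that basis. -/
lemma IsDual.ip_eq {D A B C : CircleVec} (h : IsDual D A B C) (u v : CircleVec) :
    ip u v = ip u D * ip v D - (ip u A * (ip v B + ip v C) + ip u B * (ip v A + ip v C)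
      + ip u C * (ip v A + ip v B)) / 2 := by
  have expand : ∀ (g : Fin 4 → ℝ) (w : CircleVec), ip (∑ i, g i • ![A, B, C, D] i) w =
      g 0 * ip A w + g 1 * ip B w + g 2 * ip C w + g 3 * ip D w := by
    intro g w
    rw [Fin.sum_univ_four, ip_add_left, ip_add_left, ip_add_left, ip_smul_left, ip_smul_left,
      ip_smul_left, ip_smul_left]
    rfl
  have ba := ip_comm B A
  have cb := ip_comm C B
  have ca := ip_comm C A
  have ad := ip_comm A D
  have bd := ip_comm B D
  have cd := ip_comm C D
  rw [h.ab] at ba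
  rw [h.bc] at cb
  rw [h.ac] at ca
  rw [h.da] at ad
  rw [h.db] at bd
  rw [h.dc] at cd
  have gram : ∀ (g : Fin 4 → ℝ) (w : CircleVec), ∑ i, g i • ![A, B, C, D] i = w →
      ip w A = g 0 - g 1 - g 2 ∧ ip w B = g 1 - g 0 - g 2 ∧ ip w C = g 2 - g 0 - g 1 ∧
        ip w D = g 3 := by
    rintro g w rfl
    simp only [expand, h.aa, h.bb, h.cc, h.dd, h.ab, h.bc, h.ac, h.da, h.db, h.dc, ba, cb, ca,
      ad, bd, cd]
    refine ⟨by ring, by ring, by ring, by ring⟩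
  have li : LinearIndependent ℝ ![A, B, C, D] := by
    rw [Fintype.linearIndependent_iff]
    intro g hg i
    obtain ⟨e0, e1, e2, e3⟩ := gram g 0 hg
    have z : ∀ w, ip 0 w = 0 := fun w => by simp [ip]
    rw [z] at e0 e1 e2 e3
    fin_cases i <;> simp <;> linarith
  obtain ⟨g, hg⟩ : ∃ g : Fin 4 → ℝ, ∑ i, g i • ![A, B, C, D] i = u := by
    have sp := li.span_eq_top_of_card_eq_finrank (by simp)
    exact (Submodule.mem_span_range_iff_exists_fun ℝ).mp (sp ▸ Submodule.mem_top)
  obtain ⟨e0, e1, e2, e3⟩ := gram g u hg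
  rw [e0, e1, e2, e3]
  nth_rewrite 1 [← hg]
  rw [expand, ip_comm A v, ip_comm B v, ip_comm C v, ip_comm D v]
  ring

/-- The circles orthogonal to three mutually tangent circles are the two orientations of the dual
circle. -/
lemma IsDual.eq_or_eq_neg {D D' A B C : CircleVec} (h : IsDual D A B C) (h' : IsDual D' A B C) :
    D' = D ∨ D' = -D := by
  have e : D' = (ip D' D) • D := by
    refine eq_of_forall_ip_eq fun u => ?_
    rw [h.ip_eq u D', h'.da, h'.db, h'.dc, ip_smul_right]
    ring
  have s : ip D' D * ip D' D = 1 := by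
    have := h.ip_eq D' D'
    rw [h'.da, h'.db, h'.dc, h'.dd] at this
    linarith
  rcases mul_self_eq_one_iff.mp s with s | s
  · left; rw [e, s, one_smul]
  · right; rw [e, s, neg_smul, one_smul]

/-! ### Groups generated by reflections with disjoint mirrors -/

/-- The image of `v` under the product of the reflections in the letters of `l`. -/
def word (l : List CircleVec) (v : CircleVec) : CircleVec := l.foldr refl v

@[simp] lemma word_nil (v : CircleVec) : word [] v = v := rfl

@[simp] lemma word_cons (D : CircleVec) (l : List CircleVec) (v : CircleVec) :
    word (D :: l) v = refl D (word l v) := rfl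

lemma word_append (l m : List CircleVec) (v : CircleVec) :
    word (l ++ m) v = word l (word m v) := by
  simp [word]

lemma word_eq_self {l : List CircleVec} {v : CircleVec} (h : ∀ D ∈ l, ip v D = 0) :
    word l v = v := by
  induction l with
  | nil => rfl
  | cons D l ih =>
    rw [word_cons, ih fun D' hD' => h D' (List.mem_cons_of_mem _ hD'),
      refl_eq_self (h D List.mem_cons_self)]

lemma ip_word_word {l : List CircleVec} (h : ∀ D ∈ l, ip D D = 1) (v w : CircleVec) :
    ip (word l v) (word l w) = ip v w := by
  induction l with
  | nil => rfl
  | cons D l ih =>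
    rw [word_cons, word_cons, ip_refl_refl (h D List.mem_cons_self),
      ih fun D' hD' => h D' (List.mem_cons_of_mem _ hD')]

lemma word_reverse_word {l : List CircleVec} (h : ∀ D ∈ l, ip D D = 1) (v : CircleVec) :
    word l.reverse (word l v) = v := by
  induction l with
  | nil => rfl
  | cons D l ih =>
    rw [List.reverse_cons, word_append, word_cons, word_cons, word_nil,
      refl_refl (h D List.mem_cons_self), ih fun D' hD' => h D' (List.mem_cons_of_mem _ hD')]

/-- Cancelling equal neighbours turns every word into one in which neighbours differ. -/
lemma exists_reduced_word {l : List CircleVec} (h : ∀ D ∈ l, ip D D = 1) :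
    ∃ m : List CircleVec, (∀ D ∈ m, D ∈ l) ∧ m.IsChain (· ≠ ·) ∧ ∀ v, word m v = word l v := by
  induction l with
  | nil => exact ⟨[], by simp, by simp, fun v => rfl⟩
  | cons D l ih =>
    obtain ⟨m, hm, hc, hw⟩ := ih fun D' hD' => h D' (List.mem_cons_of_mem _ hD')
    rcases m with _ | ⟨D', m⟩
    · exact ⟨[D], by simp, by simp, fun v => by simp [← hw]⟩
    · by_cases e : D = D'
      · subst e
        refine ⟨m, fun E hE => List.mem_cons_of_mem _ (hm E (List.mem_cons_of_mem _ hE)),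
          hc.tail, fun v => ?_⟩
        rw [word_cons, ← hw, word_cons, refl_refl (h D List.mem_cons_self)]
      · refine ⟨D :: D' :: m, ?_, ?_, fun v => ?_⟩
        · intro E hE
          rcases List.mem_cons.mp hE with rfl | hE
          · exact List.mem_cons_self
          · exact List.mem_cons_of_mem _ (hm E hE)
        · exact List.isChain_cons_cons.mpr ⟨e, hc⟩
        · rw [word_cons, hw, word_cons]

/-- A packing `K` of circles together with a set `M` of mirrors with disjoint interiors such that
every circle of `K` is orthogonal to, or disjoint from, every mirror. The bound `-2` is what the
dual circles of triangular gaps satisfy. -/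
structure MirrorSystem (K M : Set CircleVec) : Prop where
  ip_self : ∀ k ∈ K, ip k k = 1
  ip_le : ∀ k ∈ K, ∀ k' ∈ K, k ≠ k' → ip k k' ≤ -1
  mirror_self : ∀ D ∈ M, ip D D = 1
  mirror_le : ∀ D ∈ M, ∀ D' ∈ M, D ≠ D' → ip D D' ≤ -1
  side : ∀ k ∈ K, ∀ D ∈ M, ip k D = 0 ∨ ip k D ≤ -2

namespace MirrorSystem

variable {K M : Set CircleVec} (h : MirrorSystem K M)

/-- Ping-pong: a reduced word either fixes `v` letter by letter, or moves `v` into the mirror of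
its first letter and away from all the others. -/
lemma pingpong (h : MirrorSystem K M) {v : CircleVec} (hv : v ∈ K) {l : List CircleVec}
    (hl : ∀ D ∈ l, D ∈ M) (hc : l.IsChain (· ≠ ·)) :
    (∀ D ∈ l, ip v D = 0) ∨ ∃ D₁ m, l = D₁ :: m ∧ 2 ≤ ip (word l v) D₁ ∧
      ∀ D ∈ M, D ≠ D₁ → ip (word l v) D ≤ -ip (word l v) D₁ := by
  induction l with
  | nil => left; simp
  | cons D₁ m ih =>
    have h₁ : D₁ ∈ M := hl D₁ List.mem_cons_self
    have u₁ := h.mirror_self D₁ h₁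
    have hself : ip (word (D₁ :: m) v) D₁ = -ip (word m v) D₁ := by
      rw [word_cons, ip_refl_left, u₁]; ring
    -- enough: the word `m` moves `v` away from `D₁`
    have key : ip (word m v) D₁ ≤ -2 →
        (∀ D ∈ M, D ≠ D₁ → ip (word m v) D ≤ -ip (word m v) D₁) →
        ∀ D ∈ M, D ≠ D₁ → ip (word (D₁ :: m) v) D ≤ -ip (word (D₁ :: m) v) D₁ := by
      intro h2 hle D hD hne
      have a := h.mirror_le D₁ h₁ D hD (Ne.symm hne)
      have b := hle D hD hne
      rw [hself, word_cons, ip_refl_left]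
      nlinarith
    rcases ih (fun D hD => hl D (List.mem_cons_of_mem _ hD)) hc.tail with
      hfix | ⟨D₂, n, rfl, h2, hle⟩
    · have hw : word m v = v := word_eq_self hfix
      rcases h.side v hv D₁ h₁ with h0 | hneg
      · left
        intro D hD
        rcases List.mem_cons.mp hD with rfl | hD
        · exact h0
        · exact hfix D hD
      · right
        refine ⟨D₁, m, rfl, by rw [hself, hw]; linarith, key (by rwa [hw]) ?_⟩
        intro D hD _
        rw [hw]
        rcases h.side v hv D hD with h' | h' <;> linarith
    · right
      have hne : D₁ ≠ D₂ := (List.isChain_cons_cons.mp hc).1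
      have b := hle D₁ h₁ hne
      refine ⟨D₁, D₂ :: n, rfl, by rw [hself]; linarith, key (by linarith) ?_⟩
      intro D hD _
      by_cases e : D = D₂
      · subst e; linarith
      · linarith [hle D hD e]

/-- Along a reduced word a circle can only recede from a vector `k` on the outer side of all
mirrors. -/
lemma ip_word_le (h : MirrorSystem K M) {v : CircleVec} (hv : v ∈ K) {k : CircleVec}
    (hk : ∀ D ∈ M, ip D k ≤ 0) {l : List CircleVec} (hl : ∀ D ∈ l, D ∈ M)
    (hc : l.IsChain (· ≠ ·)) : ip (word l v) k ≤ ip v k := by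
  induction l with
  | nil => simp
  | cons D m ih =>
    have h₁ : D ∈ M := hl D List.mem_cons_self
    have hself : ip (word (D :: m) v) D = -ip (word m v) D := by
      rw [word_cons, ip_refl_left, h.mirror_self D h₁]; ring
    have hm := ih (fun D hD => hl D (List.mem_cons_of_mem _ hD)) hc.tail
    rcases h.pingpong hv hl hc with hfix | ⟨D₁, n, e, h2, -⟩
    · rw [word_eq_self hfix]
    · obtain ⟨rfl, rfl⟩ := List.cons.inj e
      rw [word_cons, ip_refl_left]
      nlinarith [hk D h₁]

/-- The same with a definite gain from the first letter. -/
lemma ip_word_cons_le (h : MirrorSystem K M) {v : CircleVec} (hv : v ∈ K) {k : CircleVec}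
    (hk : ∀ D ∈ M, ip D k ≤ 0) {D : CircleVec} {l : List CircleVec} (hl : ∀ E ∈ D :: l, E ∈ M)
    (hc : (D :: l).IsChain (· ≠ ·)) (hmove : ¬ ∀ E ∈ D :: l, ip v E = 0) :
    ip (word (D :: l) v) k ≤ ip v k + 4 * ip D k := by
  have h₁ : D ∈ M := hl D List.mem_cons_self
  have hself : ip (word (D :: l) v) D = -ip (word l v) D := by
    rw [word_cons, ip_refl_left, h.mirror_self D h₁]; ring
  have hm := h.ip_word_le hv hk (fun E hE => hl E (List.mem_cons_of_mem _ hE)) hc.tail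
  rcases h.pingpong hv hl hc with hfix | ⟨D₁, n, e, h2, -⟩
  · exact absurd hfix hmove
  · obtain ⟨rfl, rfl⟩ := List.cons.inj e
    rw [word_cons, ip_refl_left]
    nlinarith [hk D h₁]

lemma mirror_ip_nonpos (h : MirrorSystem K M) {k : CircleVec} (hk : k ∈ K) :
    ∀ D ∈ M, ip D k ≤ 0 := by
  intro D hD
  rw [ip_comm]
  rcases h.side k hk D hD with h' | h' <;> linarith

/-- The images of the circles of `K` under the reflection group form a packing. -/
lemma word_eq_or_ip_le (h : MirrorSystem K M) {v k : CircleVec} (hv : v ∈ K) (hk : k ∈ K)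
    {l : List CircleVec} (hl : ∀ D ∈ l, D ∈ M) (hc : l.IsChain (· ≠ ·)) :
    word l v = k ∨ ip (word l v) k ≤ -1 := by
  have hvk : v = k ∨ ip v k ≤ -1 := by
    by_cases e : v = k
    · exact Or.inl e
    · exact Or.inr (h.ip_le v hv k hk e)
  induction l with
  | nil => exact hvk
  | cons D m ih =>
    have h₁ : D ∈ M := hl D List.mem_cons_self
    by_cases hfix : ∀ E ∈ D :: m, ip v E = 0
    · rwa [word_eq_self hfix]
    · rcases h.side k hk D h₁ with h0 | hneg
      · rcases ih (fun E hE => hl E (List.mem_cons_of_mem _ hE)) hc.tail with e | e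
        · left; rw [word_cons, e, refl_eq_self h0]
        · right; rw [word_cons, ip_refl_comm, refl_eq_self h0]; exact e
      · right
        have a := h.ip_word_cons_le hv (h.mirror_ip_nonpos hk) hl hc hfix
        rw [ip_comm D k] at a
        have : ip v k ≤ 1 := by
          rcases hvk with e | e
          · rw [e, h.ip_self k hk]
          · linarith
        linarith

/-- A reduced word that carries a circle of `K` to a circle of `K`, as a set, fixes it letter by
letter. The third circle `k'` rules out a reversal of orientation. -/
lemma fixes_of_word_eq (h : MirrorSystem K M) (hK : ∀ a b : CircleVec, ∃ c ∈ K, c ≠ a ∧ c ≠ b)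
    {v k : CircleVec} (hv : v ∈ K) (hk : k ∈ K)
    {l : List CircleVec} (hl : ∀ D ∈ l, D ∈ M) (hc : l.IsChain (· ≠ ·))
    (e : word l v = k ∨ word l v = -k) : ∀ D ∈ l, ip v D = 0 := by
  rcases e with e | e
  · rcases h.pingpong hv hl hc with hfix | ⟨D₁, n, e', h2, -⟩
    · exact hfix
    · rw [e] at h2
      rcases h.side k hk D₁ (hl D₁ (by simp [e'])) with h' | h' <;> linarith
  · obtain ⟨k', hk', hne, hne'⟩ := hK v k
    have a := h.ip_word_le hv (h.mirror_ip_nonpos hk') hl hc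
    rw [e, ip_neg_left] at a
    have b := h.ip_le v hv k' hk' (Ne.symm hne)
    have c := h.ip_le k hk k' hk' (Ne.symm hne')
    linarith

/-- A circle of the orbit that touches `o` is the image of a circle of `K` under mirrors orthogonal
to `o`. -/
lemma exists_word_orthogonal (h : MirrorSystem K M) {o v : CircleVec} (ho : o ∈ K) (hv : v ∈ K)
    {l : List CircleVec} (hl : ∀ D ∈ l, D ∈ M) (hc : l.IsChain (· ≠ ·))
    (ht : ip (word l v) o = -1) :
    ∃ m : List CircleVec, (∀ D ∈ m, D ∈ M ∧ ip o D = 0) ∧ word m v = word l v := by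
  induction l with
  | nil => exact ⟨[], by simp, rfl⟩
  | cons D l ih =>
    have h₁ : D ∈ M := hl D List.mem_cons_self
    by_cases hfix : ∀ E ∈ D :: l, ip v E = 0
    · exact ⟨[], by simp, by rw [word_eq_self hfix, word_nil]⟩
    · rcases h.side o ho D h₁ with h0 | hneg
      · obtain ⟨m, hm, e⟩ := ih (fun E hE => hl E (List.mem_cons_of_mem _ hE)) hc.tail (by
          rwa [word_cons, ip_refl_comm, refl_eq_self h0] at ht)
        refine ⟨D :: m, ?_, by rw [word_cons, word_cons, e]⟩
        intro E hE
        rcases List.mem_cons.mp hE with rfl | hE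
        · exact ⟨h₁, h0⟩
        · exact hm E hE
      · exfalso
        have a := h.ip_word_cons_le hv (h.mirror_ip_nonpos ho) hl hc hfix
        rw [ip_comm D o, ht] at a
        have : ip v o ≤ 1 := by
          by_cases e : v = o
          · rw [e, h.ip_self o ho]
          · linarith [h.ip_le v hv o ho e]
        linarith

/-- Two circles of the orbit either belong to a common image of `K`, or are separated by an image
of a mirror. -/
lemma common_image_or_separated (h : MirrorSystem K M) {A B : CircleVec} (hA : A ∈ K) (hB : B ∈ K)
    {N : Set CircleVec} (hN : N ⊆ M) {l : List CircleVec} (hl : ∀ D ∈ l, D ∈ N)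
    (hc : l.IsChain (· ≠ ·)) :
    (∃ m : List CircleVec, (∀ D ∈ m, D ∈ N) ∧ word m A = A ∧ word m B = word l B) ∨
    ∃ m : List CircleVec, (∀ D ∈ m, D ∈ N) ∧ ∃ D ∈ N, ip A (word m D) < 0 ∧
      0 < ip (word l B) (word m D) := by
  induction l with
  | nil => exact Or.inl ⟨[], by simp, rfl, rfl⟩
  | cons D l ih =>
    have h₁ : D ∈ N := hl D List.mem_cons_self
    rcases h.pingpong hB (fun E hE => hN (hl E hE)) hc with hfix | ⟨D₁, n, e, h2, -⟩
    · exact Or.inl ⟨[], by simp, rfl, by rw [word_eq_self hfix, word_nil]⟩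
    · obtain ⟨rfl, rfl⟩ := List.cons.inj e
      have hcons : ∀ m : List CircleVec, (∀ E ∈ m, E ∈ N) → ∀ E ∈ D :: m, E ∈ N := by
        intro m hm E hE
        rcases List.mem_cons.mp hE with rfl | hE
        · exact h₁
        · exact hm E hE
      have hDD := h.mirror_self D (hN h₁)
      rcases h.side A hA D (hN h₁) with h0 | hneg
      · rcases ih (fun E hE => hl E (List.mem_cons_of_mem _ hE)) hc.tail with
          ⟨m, hm, eA, eB⟩ | ⟨m, hm, E, hE, lt, gt⟩
        · exact Or.inl ⟨D :: m, hcons m hm, by rw [word_cons, eA, refl_eq_self h0],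
            by rw [word_cons, word_cons, eB]⟩
        · refine Or.inr ⟨D :: m, hcons m hm, E, hE, ?_, ?_⟩
          · rwa [word_cons, ← ip_refl_comm, refl_eq_self h0]
          · rwa [word_cons, word_cons, ip_refl_refl hDD]
      · exact Or.inr ⟨[], by simp, D, h₁, by rw [word_nil]; linarith, by rw [word_nil]; linarith⟩

end MirrorSystem

/-! ### Circles on the sphere and their coordinates -/

/-- The isotropic vector that represents a point of the plane. -/
def pt (z : ℂ) : CircleVec := ![1, z.re, z.im, z.re ^ 2 + z.im ^ 2]

/-- The isotropic vector that represents the point `∞`. -/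
def ptInfty : CircleVec := ![0, 0, 0, 1]

/-- The isotropic vector that represents a point of the sphere. -/
def lift (z : RSphere) : CircleVec := z.elim ptInfty pt

@[simp] lemma lift_coe (z : ℂ) : lift (z : RSphere) = pt z := rfl

@[simp] lemma lift_infty : lift OnePoint.infty = ptInfty := rfl

/-- The circle on the sphere with inversive coordinates `v`. -/
def circ (v : CircleVec) : Set RSphere := {z | ip v (lift z) = 0}

lemma mem_circ {v : CircleVec} {z : RSphere} : z ∈ circ v ↔ ip v (lift z) = 0 := Iff.rfl

lemma ip_pt (v : CircleVec) (z : ℂ) :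
    ip v (pt z) = v 1 * z.re + v 2 * z.im - (v 0 * (z.re ^ 2 + z.im ^ 2) + v 3) / 2 := by
  simp [ip, pt]

lemma ip_ptInfty (v : CircleVec) : ip v ptInfty = -(v 0) / 2 := by
  simp [ip, ptInfty]; ring

lemma ip_pt_pt (z : ℂ) : ip (pt z) (pt z) = 0 := by
  rw [ip_pt]; simp [pt]; ring

lemma ip_unit {v : CircleVec} (h : ip v v = 1) : v 1 ^ 2 + v 2 ^ 2 - v 0 * v 3 = 1 := by
  rw [← h, ip]; ring

lemma circ_neg (v : CircleVec) : circ (-v) = circ v := by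
  ext z; simp [mem_circ, ip_neg_left]

/-- The coordinates of the circle with centre `c` and radius `r`, interior inside. -/
def diskVec (c : ℂ) (r : ℝ) : CircleVec :=
  ![1 / r, c.re / r, c.im / r, (c.re ^ 2 + c.im ^ 2 - r ^ 2) / r]

/-- The coordinates of the line `a + ℝ u`. -/
def lineVec (a u : ℂ) : CircleVec :=
  ![0, -u.im / ‖u‖, u.re / ‖u‖, 2 * (u.re * a.im - u.im * a.re) / ‖u‖]

/-- The coordinates of `ℝ`, with the lower half plane as its interior. -/
def realVec : CircleVec := ![0, 0, -1, 0]

/-- The coordinates of `ℝ + i`, with the half plane above it as its interior. -/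
def topVec : CircleVec := ![0, 0, 1, 2]

lemma sq_norm_eq (z : ℂ) : ‖z‖ ^ 2 = z.re ^ 2 + z.im ^ 2 := by
  rw [Complex.sq_norm, Complex.normSq_apply]; ring

lemma ip_diskVec_self (c : ℂ) {r : ℝ} (hr : 0 < r) : ip (diskVec c r) (diskVec c r) = 1 := by
  simp [ip, diskVec]; field_simp; ring

lemma ip_lineVec_self (a : ℂ) {u : ℂ} (hu : u ≠ 0) : ip (lineVec a u) (lineVec a u) = 1 := by
  have h : ‖u‖ ≠ 0 := norm_ne_zero_iff.mpr hu
  have h2 := sq_norm_eq u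
  simp [ip, lineVec]; field_simp; linarith

lemma ip_diskVec_pt (c : ℂ) {r : ℝ} (hr : 0 < r) (z : ℂ) :
    ip (diskVec c r) (pt z) = (r ^ 2 - dist z c ^ 2) / (2 * r) := by
  rw [ip_pt, dist_eq_norm, sq_norm_eq]
  simp [diskVec]; field_simp; ring

lemma ip_lineVec_pt (a : ℂ) {u : ℂ} (hu : u ≠ 0) (z : ℂ) :
    ip (lineVec a u) (pt z) = (u.re * (z.im - a.im) - u.im * (z.re - a.re)) / ‖u‖ := by
  have h : ‖u‖ ≠ 0 := norm_ne_zero_iff.mpr hu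
  rw [ip_pt]
  simp [lineVec]; field_simp; ring

lemma circ_diskVec (c : ℂ) {r : ℝ} (hr : 0 < r) : circ (diskVec c r) = euclCircle c r := by
  ext z
  induction z using OnePoint.rec with
  | infty =>
    simp only [mem_circ, lift_infty, ip_ptInfty, euclCircle]
    simp [diskVec, hr.ne']
  | coe w =>
    rw [mem_circ, lift_coe, ip_diskVec_pt c hr, euclCircle]
    simp only [Set.mem_image, OnePoint.coe_eq_coe, exists_eq_right, Metric.mem_sphere]
    have hd := dist_nonneg (x := w) (y := c)
    rw [div_eq_zero_iff]
    constructor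
    · rintro (h | h)
      · nlinarith
      · linarith
    · rintro h; left; rw [h]; ring

lemma circ_lineVec (a : ℂ) {u : ℂ} (hu : u ≠ 0) : circ (lineVec a u) = line a u := by
  have h : ‖u‖ ≠ 0 := norm_ne_zero_iff.mpr hu
  ext z
  induction z using OnePoint.rec with
  | infty =>
    simp only [mem_circ, lift_infty, ip_ptInfty, line]
    simp [lineVec]
  | coe w =>
    rw [mem_circ, lift_coe, ip_lineVec_pt a hu, line]
    simp only [Set.mem_insert_iff, OnePoint.coe_ne_infty, false_or, Set.image_univ, Set.mem_range,
      OnePoint.coe_eq_coe, div_eq_zero_iff, h, or_false]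
    constructor
    · intro e
      have hN : u.re ^ 2 + u.im ^ 2 ≠ 0 := by rw [← sq_norm_eq]; exact pow_ne_zero _ h
      refine ⟨((w.re - a.re) * u.re + (w.im - a.im) * u.im) / (u.re ^ 2 + u.im ^ 2), ?_⟩
      apply Complex.ext <;>
        simp only [Complex.add_re, Complex.add_im, Complex.mul_re, Complex.mul_im,
          Complex.ofReal_re, Complex.ofReal_im, zero_mul, sub_zero, add_zero] <;> field_simp
      · linear_combination u.im * e
      · linear_combination -u.re * e
    · rintro ⟨s, rfl⟩
      simp; ring

lemma circ_realVec : circ realVec = realLine := by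
  rw [realLine, ← circ_lineVec 0 one_ne_zero, ← circ_neg]
  congr 1
  funext i; fin_cases i <;> simp [lineVec, realVec]

lemma circ_topVec : circ topVec = topLine := by
  rw [topLine, ← circ_lineVec Complex.I one_ne_zero]
  congr 1
  funext i; fin_cases i <;> simp [lineVec, topVec]

lemma coe_mem_realLine (x : ℝ) : (((x : ℝ) : ℂ) : RSphere) ∈ realLine := by
  rw [← circ_realVec, mem_circ, lift_coe, ip_pt]; simp [realVec]

/-! ### Reflections in coordinates -/

/-- If a permutation of the sphere acts on isotropic vectors, up to scalars, as the linear
reflection in `D`, then it acts in the same way on circles. -/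
lemma smul_circ_of_lift {S : Equiv.Perm RSphere} {D : CircleVec} (hD : ip D D = 1)
    (h : ∀ z, ∃ s : ℝ, s ≠ 0 ∧ refl D (lift z) = s • lift (S z)) (v : CircleVec) :
    S • circ v = circ (refl D v) := by
  ext z
  obtain ⟨y, rfl⟩ := S.surjective z
  obtain ⟨s, hs, e⟩ := h y
  have : S y ∈ S • circ v ↔ y ∈ circ v := Set.smul_mem_smul_set_iff (a := S) (x := y)
  rw [this, mem_circ, mem_circ, ← ip_refl_refl hD v, e, ip_smul_right]
  simp [hs]

lemma refl_diskVec_lift {c : ℂ} {r : ℝ} (hr : 0 < r) (z : RSphere) :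
    ∃ s : ℝ, s ≠ 0 ∧ refl (diskVec c r) (lift z) = s • lift (inversion c r z) := by
  induction z using OnePoint.rec with
  | infty =>
    refine ⟨1 / r ^ 2, by positivity, ?_⟩
    have : inversion c r OnePoint.infty = (c : RSphere) := rfl
    rw [this, lift_infty, lift_coe, refl, ip_comm, ip_ptInfty]
    funext i
    fin_cases i <;> simp [diskVec, pt, ptInfty] <;> field_simp
    ring
  | coe w =>
    by_cases hw : w = c
    · subst hw
      refine ⟨r ^ 2, by positivity, ?_⟩
      have : inversion w r (w : RSphere) = OnePoint.infty := by simp [inversion]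
      rw [this, lift_infty, lift_coe, refl, ip_comm, ip_diskVec_pt w hr]
      funext i
      fin_cases i <;> simp [diskVec, pt, ptInfty] <;> field_simp <;> ring
    · have hN : 0 < dist w c := dist_pos.mpr hw
      refine ⟨dist w c ^ 2 / r ^ 2, by positivity, ?_⟩
      have : inversion c r (w : RSphere) =
          ((c + (r : ℂ) ^ 2 / (starRingEnd ℂ) (w - c) : ℂ) : RSphere) := by
        simp [inversion, hw]
      have e2 : dist w c ^ 2 = (w.re - c.re) ^ 2 + (w.im - c.im) ^ 2 := by
        rw [dist_eq_norm, sq_norm_eq]; simp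
      have hN' : (w.re - c.re) ^ 2 + (w.im - c.im) ^ 2 ≠ 0 := by rw [← e2]; positivity
      have e3 : (r : ℂ) ^ 2 / (starRingEnd ℂ) (w - c) =
          ⟨r ^ 2 * (w.re - c.re) / ((w.re - c.re) ^ 2 + (w.im - c.im) ^ 2),
            r ^ 2 * (w.im - c.im) / ((w.re - c.re) ^ 2 + (w.im - c.im) ^ 2)⟩ := by
        have hne : (starRingEnd ℂ) (w - c) ≠ 0 := by
          rw [map_ne_zero]; exact sub_ne_zero.mpr hw
        rw [div_eq_iff hne]
        apply Complex.ext
        · simp [← Complex.ofReal_pow]; field_simp; ring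
        · simp [← Complex.ofReal_pow]; field_simp; ring
      rw [this, lift_coe, lift_coe, refl, ip_comm, ip_diskVec_pt c hr, e2, e3]
      funext i
      fin_cases i <;> simp [diskVec, pt] <;> field_simp <;> ring

lemma refl_lineVec_lift {a u : ℂ} (hu : u ≠ 0) (z : RSphere) :
    ∃ s : ℝ, s ≠ 0 ∧ refl (lineVec a u) (lift z) = s • lift (lineReflection a u z) := by
  refine ⟨1, one_ne_zero, ?_⟩
  rw [one_smul]
  induction z using OnePoint.rec with
  | infty =>
    have : lineReflection a u OnePoint.infty = OnePoint.infty := rfl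
    rw [this, lift_infty, refl_eq_self]
    rw [ip_comm, ip_ptInfty]; simp [lineVec]
  | coe w =>
    have : lineReflection a u (w : RSphere) =
        ((a + u * (starRingEnd ℂ) ((w - a) / u) : ℂ) : RSphere) := rfl
    have h : ‖u‖ ≠ 0 := norm_ne_zero_iff.mpr hu
    have h2 := sq_norm_eq u
    have hN : u.re ^ 2 + u.im ^ 2 ≠ 0 := by rw [← h2]; positivity
    have e : u * (starRingEnd ℂ) ((w - a) / u) =
        ⟨((u.re ^ 2 - u.im ^ 2) * (w.re - a.re) + 2 * u.re * u.im * (w.im - a.im)) /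
            (u.re ^ 2 + u.im ^ 2),
          (2 * u.re * u.im * (w.re - a.re) - (u.re ^ 2 - u.im ^ 2) * (w.im - a.im)) /
            (u.re ^ 2 + u.im ^ 2)⟩ := by
      have hne : (starRingEnd ℂ) u ≠ 0 := by rwa [map_ne_zero]
      rw [map_div₀, mul_div_assoc', div_eq_iff hne]
      apply Complex.ext
      · simp; field_simp; ring
      · simp; field_simp; ring
    rw [this, lift_coe, lift_coe, refl, ip_comm, ip_lineVec_pt a hu, e]
    funext i
    fin_cases i
    · simp [lineVec, pt]
    · simp [lineVec, pt]; field_simp; rw [h2]; field_simp; ring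
    · simp [lineVec, pt]; field_simp; rw [h2]; field_simp; ring
    · simp [lineVec, pt]; field_simp; rw [h2]; field_simp; ring

lemma IsReflectionIn.exists_vec {D : Set RSphere} {S : Equiv.Perm RSphere}
    (h : IsReflectionIn D S) :
    ∃ v : CircleVec, ip v v = 1 ∧ D = circ v ∧ ∀ w, S • circ w = circ (refl v w) := by
  rcases h with ⟨c, r, hr, rfl, hS⟩ | ⟨a, u, hu, rfl, hS⟩
  · refine ⟨diskVec c r, ip_diskVec_self c hr, (circ_diskVec c hr).symm, ?_⟩
    refine smul_circ_of_lift (ip_diskVec_self c hr) fun z => ?_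
    rw [hS]; exact refl_diskVec_lift hr z
  · refine ⟨lineVec a u, ip_lineVec_self a hu, (circ_lineVec a hu).symm, ?_⟩
    refine smul_circ_of_lift (ip_lineVec_self a hu) fun z => ?_
    rw [hS]; exact refl_lineVec_lift hu z

/-! ### Circles, tangency and curvature in coordinates -/

/-- Two circles that meet have inner product at most `1` in absolute value. -/
lemma sq_ip_le_one_of_mem {v w : CircleVec} (hv : ip v v = 1) (hw : ip w w = 1) {z : RSphere}
    (hzv : z ∈ circ v) (hzw : z ∈ circ w) : ip v w ^ 2 ≤ 1 := by
  have hv' := ip_unit hv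
  have hw' := ip_unit hw
  have cs : ∀ a b c d e : ℝ, a ^ 2 + b ^ 2 = 1 → c ^ 2 + d ^ 2 = 1 → e = a * c + b * d →
      e ^ 2 ≤ 1 := by
    rintro a b c d e h1 h2 rfl
    have : (a * c + b * d) ^ 2 + (a * d - b * c) ^ 2 = (a ^ 2 + b ^ 2) * (c ^ 2 + d ^ 2) := by ring
    rw [h1, h2] at this
    nlinarith [sq_nonneg (a * d - b * c)]
  induction z using OnePoint.rec with
  | infty =>
    rw [mem_circ, lift_infty, ip_ptInfty] at hzv hzw
    have h1 : v 0 = 0 := by linarith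
    have h2 : w 0 = 0 := by linarith
    rw [h1] at hv'
    rw [h2] at hw'
    refine cs (v 1) (v 2) (w 1) (w 2) _ (by linarith) (by linarith) ?_
    rw [ip, h1, h2]; ring
  | coe p =>
    rw [mem_circ, lift_coe, ip_pt] at hzv hzw
    -- move `p` to the origin
    refine cs (v 1 - v 0 * p.re) (v 2 - v 0 * p.im) (w 1 - w 0 * p.re) (w 2 - w 0 * p.im) _ ?_ ?_ ?_
    · linear_combination hv' - 2 * v 0 * hzv
    · linear_combination hw' - 2 * w 0 * hzw
    · rw [ip]; linear_combination w 0 * hzv + v 0 * hzw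

/-- A circle determines its coordinates up to sign. -/
lemma eq_or_eq_neg_of_circ_eq {v w : CircleVec} (hv : ip v v = 1) (hw : ip w w = 1)
    (h : circ v = circ w) : v = w ∨ v = -w := by
  have hv' := ip_unit hv
  have hw' := ip_unit hw
  have sub : ∀ z : RSphere, ip v (lift z) = 0 → ip w (lift z) = 0 := fun z hz => by
    have : z ∈ circ w := h ▸ (show z ∈ circ v from hz)
    exact this
  -- it is enough to find a proportionality factor
  suffices hs : ∃ s : ℝ, w = s • v by
    obtain ⟨s, rfl⟩ := hs
    rw [ip_smul_left, ip_smul_right, hv, mul_one] at hw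
    rcases mul_self_eq_one_iff.mp hw with rfl | rfl
    · left; simp
    · right; simp
  have four : ∀ s : ℝ, w 0 = s * v 0 → w 1 = s * v 1 → w 2 = s * v 2 → w 3 = s * v 3 →
      ∃ s : ℝ, w = s • v := by
    intro s h0 h1 h2 h3
    refine ⟨s, ?_⟩
    funext i; fin_cases i <;> simp [*]
  by_cases h0 : v 0 = 0
  · have h0' : w 0 = 0 := by
      have := sub OnePoint.infty (by rw [lift_infty, ip_ptInfty, h0]; simp)
      rw [lift_infty, ip_ptInfty] at this
      linarith
    rw [h0] at hv'
    have q0 := sub ((⟨v 3 / 2 * v 1, v 3 / 2 * v 2⟩ : ℂ) : RSphere) (by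
      rw [lift_coe, ip_pt, h0]; simp only []
      linear_combination v 3 / 2 * hv')
    have q1 := sub ((⟨v 3 / 2 * v 1 - v 2, v 3 / 2 * v 2 + v 1⟩ : ℂ) : RSphere) (by
      rw [lift_coe, ip_pt, h0]; simp only []
      linear_combination v 3 / 2 * hv')
    rw [lift_coe, ip_pt, h0'] at q0 q1
    simp only [] at q0 q1
    have e : w 2 * v 1 = w 1 * v 2 := by linarith
    refine four (w 1 * v 1 + w 2 * v 2) (by rw [h0, h0']; ring) ?_ ?_ ?_
    · linear_combination -w 1 * hv' - v 2 * e
    · linear_combination -w 2 * hv' + v 1 * e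
    · linear_combination -2 * q0
  · have p : ∀ x y : ℝ, x ^ 2 + y ^ 2 = 1 →
        ip w (pt ⟨(v 1 + x) / v 0, (v 2 + y) / v 0⟩) = 0 := by
      intro x y hxy
      refine sub ((⟨(v 1 + x) / v 0, (v 2 + y) / v 0⟩ : ℂ) : RSphere) ?_
      rw [lift_coe, ip_pt]
      simp only []
      field_simp
      linear_combination hv' - hxy
    have p1 := p 1 0 (by norm_num)
    have p2 := p (-1) 0 (by norm_num)
    have p3 := p 0 1 (by norm_num)
    have p4 := p 0 (-1) (by norm_num)
    rw [ip_pt] at p1 p2 p3 p4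
    simp only [] at p1 p2 p3 p4
    field_simp at p1 p2 p3 p4
    have e1 : w 1 * v 0 = w 0 * v 1 := by linear_combination (p1 - p2) / 4
    have e2 : w 2 * v 0 = w 0 * v 2 := by linear_combination (p3 - p4) / 4
    refine four (w 0 / v 0) (by field_simp) (by field_simp; linarith) (by field_simp; linarith) ?_
    have : v 0 * (w 3 * v 0 - w 0 * v 3) = 0 := by
      linear_combination -(p1 + p2) / 2 + 2 * v 1 * e1 + 2 * v 2 * e2 + w 0 * hv'
    rcases mul_eq_zero.mp this with h | h
    · exact absurd h h0
    · field_simp; linarith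

lemma HasCurvature.eq_abs {v : CircleVec} (hv : ip v v = 1) {κ : ℝ}
    (h : HasCurvature (circ v) κ) : κ = |v 0| := by
  rcases h with ⟨c, r, hr, e, rfl⟩ | ⟨a, u, hu, e, rfl⟩
  · rw [← circ_diskVec c hr] at e
    rcases eq_or_eq_neg_of_circ_eq hv (ip_diskVec_self c hr) e with rfl | rfl <;>
      simp [diskVec, abs_of_pos hr]
  · rw [← circ_lineVec a hu] at e
    rcases eq_or_eq_neg_of_circ_eq hv (ip_lineVec_self a hu) e with rfl | rfl <;> simp [lineVec]

lemma hasCurvature_circ {v : CircleVec} (hv : ip v v = 1) (h0 : 0 < v 0) :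
    HasCurvature (circ v) (v 0) := by
  have hr : 0 < 1 / v 0 := by positivity
  refine Or.inl ⟨⟨v 1 / v 0, v 2 / v 0⟩, 1 / v 0, hr, ?_, by field_simp⟩
  rw [← circ_diskVec _ hr]
  congr 1
  have hv' := ip_unit hv
  funext i
  fin_cases i <;> simp [diskVec] <;> field_simp
  linarith

/-- A permutation of the sphere is determined by its action on circles, because each point is the
intersection of two tangent circles. -/
lemma eq_one_of_smul_circ {g : Equiv.Perm RSphere}
    (h : ∀ v, ip v v = 1 → g • circ v = circ v) : g = 1 := by
  have key : ∀ (v w : CircleVec) (z : RSphere), ip v v = 1 → ip w w = 1 → circ v ∩ circ w = {z} →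
      g z = z := by
    intro v w z hv hw e
    have : g • (circ v ∩ circ w) = circ v ∩ circ w := by
      rw [Set.smul_set_inter, h v hv, h w hw]
    rw [e, Set.smul_set_singleton] at this
    exact Set.singleton_injective this
  ext1 z
  rw [Equiv.Perm.one_apply]
  induction z using OnePoint.rec with
  | infty =>
    refine key realVec topVec _ (by simp [ip, realVec]) (by simp [ip, topVec]) ?_
    ext z
    induction z using OnePoint.rec with
    | infty => simp [mem_circ, ip_ptInfty, realVec, topVec]
    | coe w =>
      simp only [Set.mem_inter_iff, mem_circ, lift_coe, ip_pt, Set.mem_singleton_iff,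
        OnePoint.coe_ne_infty, iff_false, not_and]
      intro h1 h2
      simp [realVec] at h1
      simp [topVec, h1] at h2
  | coe p =>
    refine key (diskVec (p + 1) 1) (diskVec (p - 1) 1) _ (ip_diskVec_self _ one_pos)
      (ip_diskVec_self _ one_pos) ?_
    ext z
    induction z using OnePoint.rec with
    | infty => simp [mem_circ, ip_ptInfty, diskVec]
    | coe w =>
      simp only [Set.mem_inter_iff, mem_circ, lift_coe, ip_pt, Set.mem_singleton_iff,
        OnePoint.coe_eq_coe]
      simp [diskVec]
      constructor
      · rintro ⟨h1, h2⟩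
        have h3 : w.re = p.re := by linarith
        rw [h3] at h1
        have h4 : (w.im - p.im) ^ 2 = 0 := by linarith
        exact Complex.ext h3 (by linarith [pow_eq_zero_iff (two_ne_zero) |>.mp h4])
      · rintro rfl
        constructor <;> ring

/-- The vector `A + B` of two tangent circles is isotropic: it represents their point of contact,
so a circle through that point is orthogonal to it. -/
lemma ip_add_ip_eq_zero {A B D : CircleVec} (hA : ip A A = 1) (hB : ip B B = 1)
    (hAB : ip A B = -1) (h : circ A ∩ circ B ⊆ circ D) : ip D A + ip D B = 0 := by
  have zA : ip A (A + B) = 0 := by rw [ip_comm, ip_add_left, hA, ip_comm B A, hAB]; ring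
  have zB : ip B (A + B) = 0 := by rw [ip_comm, ip_add_left, hB, hAB]; ring
  have iso : ip (A + B) (A + B) = 0 := by rw [ip_add_left, zA, zB, add_zero]
  have goal : ip D (A + B) = ip D A + ip D B := by
    rw [ip_comm, ip_add_left, ip_comm A, ip_comm B]
  rw [← goal]
  set m := A + B
  clear_value m
  -- an isotropic vector is a multiple of that of a point
  suffices hs : m = 0 ∨ ∃ (s : ℝ) (z : RSphere), s ≠ 0 ∧ m = s • lift z by
    rcases hs with hs | ⟨s, z, hs, e⟩
    · rw [hs]; simp [ip]
    · rw [e, ip_smul_right] at zA zB ⊢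
      have hz : z ∈ circ D := h ⟨(mul_eq_zero.mp zA).resolve_left hs,
        (mul_eq_zero.mp zB).resolve_left hs⟩
      rw [mem_circ.mp hz, mul_zero]
  have iso' : m 1 ^ 2 + m 2 ^ 2 = m 0 * m 3 := by
    rw [ip] at iso; linarith
  by_cases h0 : m 0 = 0
  · rw [h0] at iso'
    have h1 : m 1 = 0 := by nlinarith
    have h2 : m 2 = 0 := by nlinarith
    by_cases h3 : m 3 = 0
    · left; funext i; fin_cases i <;> simp [*]
    · right
      refine ⟨m 3, OnePoint.infty, h3, ?_⟩
      funext i; fin_cases i <;> simp [ptInfty, *]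
  · right
    refine ⟨m 0, ((⟨m 1 / m 0, m 2 / m 0⟩ : ℂ) : RSphere), h0, ?_⟩
    funext i; fin_cases i <;> simp [pt] <;> field_simp
    linarith

/-- For a point of contact `x` with the real axis, the vector `v + realVec` is a multiple of the
vector of `x`. -/
lemma add_realVec_eq {v : CircleVec} (hv : ip v v = 1) (ho : ip v realVec = -1) {x : ℝ}
    (hx : (((x : ℝ) : ℂ) : RSphere) ∈ circ v) : v + realVec = v 0 • pt (x : ℂ) := by
  have h2 : v 2 = 1 := by simp [ip, realVec] at ho; linarith
  have hv' := ip_unit hv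
  rw [h2] at hv'
  rw [mem_circ, lift_coe, ip_pt] at hx
  simp at hx
  have h1 : v 1 = v 0 * x := by
    have : (v 1 - v 0 * x) ^ 2 = 0 := by linear_combination hv' - 2 * v 0 * hx
    linarith [pow_eq_zero_iff (two_ne_zero) |>.mp this]
  funext i; fin_cases i <;> simp [pt, realVec, h2]
  · linarith
  · rw [h1] at hx; linarith

/-! ### Connectedness of the interstices of three mutually tangent circles -/

/-- The interstice of three mutually tangent circles `A`, `B`, `C` on the interior side of their
dual circle `D`, which is the unbounded side if `D 0 < 0`. -/
def interstice (D A B C : CircleVec) : Set ℂ :=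
  {w | ip A (pt w) < 0 ∧ ip B (pt w) < 0 ∧ ip C (pt w) < 0 ∧ 0 < ip D (pt w)}

/-- The centre of the circle with coordinates `D`. -/
def centre (D : CircleVec) : ℂ := ⟨D 1 / D 0, D 2 / D 0⟩

lemma ip_pt_centre_add {D : CircleVec} (hD : ip D D = 1) (h0 : D 0 ≠ 0) (u : ℂ) :
    D 0 * ip D (pt (centre D + u)) = (1 - D 0 ^ 2 * (u.re ^ 2 + u.im ^ 2)) / 2 := by
  have := ip_unit hD
  rw [ip_pt]
  simp [centre]
  field_simp
  linear_combination this

/-- A circle orthogonal to `D`, in polar coordinates about the centre of `D`. -/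
lemma ip_pt_centre_add_mul {D A : CircleVec} (hD : ip D D = 1) (hA : ip D A = 0) (h0 : D 0 ≠ 0)
    (s : ℝ) (u : ℂ) :
    ip A (pt (centre D + s * u)) =
      s * (A 1 * u.re + A 2 * u.im - A 0 * (D 1 * u.re + D 2 * u.im) / D 0)
        - A 0 * (s ^ 2 * (u.re ^ 2 + u.im ^ 2) + 1 / D 0 ^ 2) / 2 := by
  have h1 := ip_unit hD
  rw [ip] at hA
  rw [ip_pt]
  simp [centre]
  field_simp
  linear_combination (-A 0) * h1 + 2 * D 0 * hA

/-- Moving radially away from the circle `D`, towards the centre on the inside and outwards on the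
outside, does not lead into the disk of a circle `A` orthogonal to it. -/
lemma ip_pt_dilate_neg {D A : CircleVec} (hD : ip D D = 1) (hA : ip D A = 0) (h0 : D 0 ≠ 0)
    (hA0 : 0 ≤ A 0) {s : ℝ} (hs : 0 < s) {u : ℂ}
    (hsu : 0 ≤ (1 - s) * (1 - D 0 ^ 2 * (s * (u.re ^ 2 + u.im ^ 2))))
    (hu : ip A (pt (centre D + u)) < 0) : ip A (pt (centre D + s * u)) < 0 := by
  have h1 := ip_pt_centre_add_mul hD hA h0 1 u
  rw [Complex.ofReal_one, one_mul] at h1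
  rw [h1] at hu
  rw [ip_pt_centre_add_mul hD hA h0]
  set l := A 1 * u.re + A 2 * u.im - A 0 * (D 1 * u.re + D 2 * u.im) / D 0
  set N := u.re ^ 2 + u.im ^ 2
  have hR : 0 < 1 / D 0 ^ 2 := by positivity
  have e : (1 - s) * (1 - D 0 ^ 2 * (s * N)) = D 0 ^ 2 * ((1 - s) * (1 / D 0 ^ 2 - s * N)) := by
    field_simp
  rw [e] at hsu
  have h2 : 0 ≤ (1 - s) * (1 / D 0 ^ 2 - s * N) :=
    nonneg_of_mul_nonneg_right hsu (by positivity)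
  have h3 := mul_nonneg hA0 h2
  have h4 := mul_neg_of_pos_of_neg hs hu
  nlinarith

/-- Two points inside `D` and outside the disk of a circle `A` orthogonal to `D` are joined by a
segment outside that disk once both have been moved halfway to the centre of `D`. -/
lemma ip_pt_centre_combo_neg {D A : CircleVec} (hD : ip D D = 1) (hA : ip D A = 0) (h0 : 0 < D 0)
    (hA0 : 0 ≤ A 0) {u u' : ℂ} (hu : ip A (pt (centre D + u)) < 0)
    (hu' : ip A (pt (centre D + u')) < 0) (hDu : 0 < ip D (pt (centre D + u)))
    (hDu' : 0 < ip D (pt (centre D + u'))) {a b : ℝ} (ha : 0 ≤ a) (hb : 0 ≤ b) (hab : a + b = 1) :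
    ip A (pt (centre D + (1 / 2 : ℝ) * (a * u + b * u'))) < 0 := by
  have h1 := ip_pt_centre_add_mul hD hA h0.ne' 1 u
  have h1' := ip_pt_centre_add_mul hD hA h0.ne' 1 u'
  rw [Complex.ofReal_one, one_mul] at h1 h1'
  rw [h1] at hu
  rw [h1'] at hu'
  have k := ip_pt_centre_add hD h0.ne' u
  have k' := ip_pt_centre_add hD h0.ne' u'
  have m : 0 < (1 - D 0 ^ 2 * (u.re ^ 2 + u.im ^ 2)) / 2 := k ▸ mul_pos h0 hDu
  have m' : 0 < (1 - D 0 ^ 2 * (u'.re ^ 2 + u'.im ^ 2)) / 2 := k' ▸ mul_pos h0 hDu'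
  have e : ∀ N : ℝ, 0 < (1 - D 0 ^ 2 * N) / 2 → N ≤ 1 / D 0 ^ 2 := by
    intro N hN
    rw [le_div_iff₀ (by positivity)]
    linarith
  have n := mul_le_mul_of_nonneg_left (e _ m) hA0
  have n' := mul_le_mul_of_nonneg_left (e _ m') hA0
  rw [ip_pt_centre_add_mul hD hA h0.ne']
  have re : (a * u + b * u' : ℂ).re = a * u.re + b * u'.re := by simp
  have im : (a * u + b * u' : ℂ).im = a * u.im + b * u'.im := by simp
  rw [re, im]
  have lin : A 1 * (a * u.re + b * u'.re) + A 2 * (a * u.im + b * u'.im)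
      - A 0 * (D 1 * (a * u.re + b * u'.re) + D 2 * (a * u.im + b * u'.im)) / D 0 =
      a * (A 1 * u.re + A 2 * u.im - A 0 * (D 1 * u.re + D 2 * u.im) / D 0) +
      b * (A 1 * u'.re + A 2 * u'.im - A 0 * (D 1 * u'.re + D 2 * u'.im) / D 0) := by ring
  rw [lin]
  set l := A 1 * u.re + A 2 * u.im - A 0 * (D 1 * u.re + D 2 * u.im) / D 0
  set l' := A 1 * u'.re + A 2 * u'.im - A 0 * (D 1 * u'.re + D 2 * u'.im) / D 0
  set R := 1 / D 0 ^ 2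
  clear_value l l' R
  have hl : l < A 0 * R := by linarith
  have hl' : l' < A 0 * R := by linarith
  have hc : a * l + b * l' < A 0 * R := by
    have : A 0 * R = a * (A 0 * R) + b * (A 0 * R) := by
      rw [← add_mul, hab, one_mul]
    rw [this]
    rcases ha.eq_or_lt with rfl | ha
    · have : b = 1 := by linarith
      subst this; linarith
    · have := mul_lt_mul_of_pos_left hl ha
      have := mul_le_mul_of_nonneg_left hl'.le hb
      linarith
  have sq := mul_nonneg hA0 (add_nonneg (sq_nonneg (a * u.re + b * u'.re))
    (sq_nonneg (a * u.im + b * u'.im)))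
  set S := (a * u.re + b * u'.re) ^ 2 + (a * u.im + b * u'.im) ^ 2
  clear_value S
  linarith

/-- If the dual circle is a genuine circle with its interior inside, two points of the interstice
are joined by moving both halfway to its centre. -/
lemma joinedIn_interstice_of_pos {D A B C : CircleVec} (h : IsDual D A B C) (hA : 0 ≤ A 0)
    (hB : 0 ≤ B 0) (hC : 0 ≤ C 0) (h0 : 0 < D 0) {z e : ℂ} (hz : z ∈ interstice D A B C)
    (he : e ∈ interstice D A B C) : JoinedIn (interstice D A B C) z e := by
  have hz' : z = centre D + (z - centre D) := by ring
  have he' : e = centre D + (e - centre D) := by ring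
  rw [hz'] at hz ⊢
  rw [he'] at he ⊢
  generalize z - centre D = u at hz ⊢
  generalize e - centre D = u' at he ⊢
  have inside : ∀ v : ℂ, 0 < ip D (pt (centre D + v)) ↔ D 0 ^ 2 * (v.re ^ 2 + v.im ^ 2) < 1 := by
    intro v
    have := ip_pt_centre_add h.dd h0.ne' v
    constructor
    · intro hv
      have := this ▸ mul_pos h0 hv
      linarith
    · intro hv
      have : 0 < D 0 * ip D (pt (centre D + v)) := by rw [this]; linarith
      exact pos_of_mul_pos_right this h0.le
  -- the radial segments
  have radial : ∀ u : ℂ, centre D + u ∈ interstice D A B C →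
      JoinedIn (interstice D A B C) (centre D + u) (centre D + (1 / 2 : ℝ) * u) := by
    intro u hu
    refine JoinedIn.of_segment_subset ?_
    rintro w ⟨a, b, ha, hb, hab, rfl⟩
    have e : a • (centre D + u) + b • (centre D + (1 / 2 : ℝ) * u) =
        centre D + ((a + b / 2 : ℝ) : ℂ) * u := by
      have : (a : ℂ) + b = 1 := by exact_mod_cast hab
      simp only [Complex.real_smul]; push_cast
      linear_combination (centre D) * this
    rw [e]
    have hs : 0 < a + b / 2 := by linarith
    have hs1 : a + b / 2 ≤ 1 := by linarith
    obtain ⟨h1, h2, h3, h4⟩ := hu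
    rw [inside] at h4
    have hN : 0 ≤ u.re ^ 2 + u.im ^ 2 := by positivity
    have hsu : 0 ≤ (1 - (a + b / 2)) * (1 - D 0 ^ 2 * ((a + b / 2) * (u.re ^ 2 + u.im ^ 2))) := by
      refine mul_nonneg (by linarith) ?_
      have : 0 ≤ D 0 ^ 2 * (u.re ^ 2 + u.im ^ 2) := by positivity
      nlinarith
    refine ⟨ip_pt_dilate_neg h.dd h.da h0.ne' hA hs hsu h1,
      ip_pt_dilate_neg h.dd h.db h0.ne' hB hs hsu h2,
      ip_pt_dilate_neg h.dd h.dc h0.ne' hC hs hsu h3, ?_⟩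
    rw [inside]
    have e : (((a + b / 2 : ℝ) : ℂ) * u).re ^ 2 + (((a + b / 2 : ℝ) : ℂ) * u).im ^ 2 =
        (a + b / 2) ^ 2 * (u.re ^ 2 + u.im ^ 2) := by
      rw [Complex.re_ofReal_mul, Complex.im_ofReal_mul]; ring
    rw [e]
    have : (a + b / 2) ^ 2 ≤ 1 := by nlinarith
    have : 0 ≤ D 0 ^ 2 * (u.re ^ 2 + u.im ^ 2) := by positivity
    nlinarith
  refine (radial u hz).trans (JoinedIn.trans ?_ (radial u' he).symm)
  refine JoinedIn.of_segment_subset ?_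
  rintro w ⟨a, b, ha, hb, hab, rfl⟩
  have e : a • (centre D + (1 / 2 : ℝ) * u) + b • (centre D + (1 / 2 : ℝ) * u') =
      centre D + (1 / 2 : ℝ) * (a * u + b * u') := by
    have : (a : ℂ) + b = 1 := by exact_mod_cast hab
    simp only [Complex.real_smul]
    linear_combination (centre D) * this
  rw [e]
  obtain ⟨h1, h2, h3, h4⟩ := hz
  obtain ⟨k1, k2, k3, k4⟩ := he
  refine ⟨ip_pt_centre_combo_neg h.dd h.da h0 hA h1 k1 h4 k4 ha hb hab,
    ip_pt_centre_combo_neg h.dd h.db h0 hB h2 k2 h4 k4 ha hb hab,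
    ip_pt_centre_combo_neg h.dd h.dc h0 hC h3 k3 h4 k4 ha hb hab, ?_⟩
  rw [inside] at h4 k4 ⊢
  simp only [Complex.re_ofReal_mul, Complex.im_ofReal_mul, Complex.add_re, Complex.add_im]
  have sq : ∀ x y : ℝ, (a * x + b * y) ^ 2 ≤ a * x ^ 2 + b * y ^ 2 := by
    intro x y
    have : b = 1 - a := by linarith
    subst this
    nlinarith [mul_nonneg (mul_nonneg ha hb) (sq_nonneg (x - y))]
  have s1 := sq u.re u'.re
  have s2 := sq u.im u'.im
  have hp : 0 < D 0 ^ 2 := by positivity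
  have s3 := mul_le_mul_of_nonneg_left (add_le_add s1 s2) hp.le
  have s4 : 0 ≤ D 0 ^ 2 * ((a * u.re + b * u'.re) ^ 2 + (a * u.im + b * u'.im) ^ 2) := by positivity
  have s5 := mul_le_mul_of_nonneg_left h4.le ha
  have s6 := mul_le_mul_of_nonneg_left k4.le hb
  nlinarith

/-- If the dual circle is a line, two points of the interstice are joined by moving both far away
from it. -/
lemma joinedIn_interstice_of_eq_zero {D A B C : CircleVec} (h : IsDual D A B C) (hA : 0 ≤ A 0)
    (hB : 0 ≤ B 0) (hC : 0 ≤ C 0) (h0 : D 0 = 0) {z e : ℂ} (hz : z ∈ interstice D A B C)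
    (he : e ∈ interstice D A B C) : JoinedIn (interstice D A B C) z e := by
  have hu := ip_unit h.dd
  rw [h0] at hu
  set n : ℂ := ⟨D 1, D 2⟩ with hn
  have moveD : ∀ (w : ℂ) (s : ℝ), ip D (pt (w + s * n)) = ip D (pt w) + s := by
    intro w s
    rw [ip_pt, ip_pt, h0]; simp [hn]
    linear_combination s * hu
  have moveX : ∀ X : CircleVec, ip D X = 0 → ∀ (w : ℂ) (s : ℝ),
      ip X (pt (w + s * n)) = ip X (pt w) - s * X 0 * ip D (pt w) - X 0 * s ^ 2 / 2 := by
    intro X hX w s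
    rw [ip, h0] at hX
    rw [ip_pt, ip_pt, ip_pt, h0]; simp [hn]
    linear_combination s * hX - X 0 * s ^ 2 / 2 * hu
  have moveXneg : ∀ X : CircleVec, ip D X = 0 → 0 ≤ X 0 → ∀ (w : ℂ) (s : ℝ), 0 ≤ s →
      ip X (pt w) < 0 → 0 < ip D (pt w) → ip X (pt (w + s * n)) < 0 := by
    intro X hX hX0 w s hs h1 h2
    rw [moveX X hX]
    have := mul_nonneg (mul_nonneg hs hX0) h2.le
    have := mul_nonneg hX0 (sq_nonneg s)
    linarith
  have shift : ∀ (s : ℝ), 0 ≤ s → ∀ w ∈ interstice D A B C,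
      JoinedIn (interstice D A B C) w (w + s * n) := by
    intro s hs w hw
    refine JoinedIn.of_segment_subset ?_
    rintro x ⟨a, b, ha, hb, hab, rfl⟩
    have e : a • w + b • (w + s * n) = w + ((b * s : ℝ) : ℂ) * n := by
      have : (a : ℂ) + b = 1 := by exact_mod_cast hab
      simp only [Complex.real_smul]; push_cast
      linear_combination w * this
    rw [e]
    obtain ⟨h1, h2, h3, h4⟩ := hw
    have hbs : 0 ≤ b * s := mul_nonneg hb hs
    refine ⟨moveXneg A h.da hA w _ hbs h1 h4, moveXneg B h.db hB w _ hbs h2 h4,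
      moveXneg C h.dc hC w _ hbs h3 h4, ?_⟩
    rw [moveD]; linarith
  -- this far away, the segment between the two points stays clear of the three disks
  set s : ℝ := ‖z - e‖ with hs
  have hs0 : 0 ≤ s := norm_nonneg _
  have hs2 : s ^ 2 = (z.re - e.re) ^ 2 + (z.im - e.im) ^ 2 := by
    rw [hs, sq_norm_eq]; simp
  refine (shift s hs0 z hz).trans (JoinedIn.trans ?_ (shift s hs0 e he).symm)
  refine JoinedIn.of_segment_subset ?_
  rintro w ⟨a, b, ha, hb, hab, rfl⟩
  have e' : a • (z + s * n) + b • (e + s * n) = (a * z + b * e) + s * n := by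
    have : (a : ℂ) + b = 1 := by exact_mod_cast hab
    simp only [Complex.real_smul]
    linear_combination (s * n) * this
  rw [e']
  have convex : ∀ X : CircleVec, ip X (pt (a * z + b * e)) =
      a * ip X (pt z) + b * ip X (pt e) + X 0 * (a * b) * s ^ 2 / 2 := by
    intro X
    have : b = 1 - a := by linarith
    subst this
    rw [ip_pt, ip_pt, ip_pt, hs2]; simp; ring
  have hab1 : a * b ≤ 1 := by nlinarith
  have combo : ∀ p q : ℝ, 0 < p → 0 < q → 0 < a * p + b * q := by
    intro p q hp hq
    rcases ha.eq_or_lt with rfl | ha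
    · have : b = 1 := by linarith
      subst this; linarith
    · have := mul_pos ha hp
      have := mul_nonneg hb hq.le
      linarith
  obtain ⟨h1, h2, h3, h4⟩ := hz
  obtain ⟨k1, k2, k3, k4⟩ := he
  have hD : 0 < ip D (pt (a * z + b * e)) := by
    rw [convex, h0]; have := combo _ _ h4 k4; linarith
  have neg : ∀ X : CircleVec, ip D X = 0 → 0 ≤ X 0 → ip X (pt z) < 0 → ip X (pt e) < 0 →
      ip X (pt (a * z + b * e + s * n)) < 0 := by
    intro X hX hX0 hXz hXe
    rw [moveX X hX, convex]
    have c := combo _ _ (neg_pos.mpr hXz) (neg_pos.mpr hXe)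
    have := mul_nonneg (mul_nonneg hs0 hX0) hD.le
    have := mul_nonneg hX0 (mul_nonneg (sq_nonneg s) (sub_nonneg.mpr hab1))
    nlinarith
  refine ⟨neg A h.da hA h1 k1, neg B h.db hB h2 k2, neg C h.dc hC h3 k3, ?_⟩
  rw [moveD]; linarith

/-- If the dual circle has its exterior inside, the interstice contains the outward radial rays. -/
lemma ray_mem_interstice {D A B C : CircleVec} (h : IsDual D A B C) (hA : 0 ≤ A 0)
    (hB : 0 ≤ B 0) (hC : 0 ≤ C 0) (h0 : D 0 < 0) {u : ℂ}
    (hu : centre D + u ∈ interstice D A B C) {s : ℝ} (hs : 1 ≤ s) :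
    centre D + s * u ∈ interstice D A B C := by
  have outside : ∀ v : ℂ, 0 < ip D (pt (centre D + v)) ↔ 1 < D 0 ^ 2 * (v.re ^ 2 + v.im ^ 2) := by
    intro v
    have := ip_pt_centre_add h.dd h0.ne v
    constructor
    · intro hv
      have := this ▸ mul_neg_of_neg_of_pos h0 hv
      linarith
    · intro hv
      have : D 0 * ip D (pt (centre D + v)) < 0 := by rw [this]; linarith
      exact pos_of_mul_neg_right this h0.le
  obtain ⟨h1, h2, h3, h4⟩ := hu
  rw [outside] at h4
  have hs0 : 0 < s := by linarith
  have hsu : 0 ≤ (1 - s) * (1 - D 0 ^ 2 * (s * (u.re ^ 2 + u.im ^ 2))) := by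
    refine mul_nonneg_of_nonpos_of_nonpos (by linarith) ?_
    nlinarith
  refine ⟨ip_pt_dilate_neg h.dd h.da h0.ne hA hs0 hsu h1,
    ip_pt_dilate_neg h.dd h.db h0.ne hB hs0 hsu h2,
    ip_pt_dilate_neg h.dd h.dc h0.ne hC hs0 hsu h3, ?_⟩
  rw [outside]
  have e : ((s : ℂ) * u).re ^ 2 + ((s : ℂ) * u).im ^ 2 = s ^ 2 * (u.re ^ 2 + u.im ^ 2) := by
    rw [Complex.re_ofReal_mul, Complex.im_ofReal_mul]; ring
  rw [e]
  have : 1 ≤ s ^ 2 := by nlinarith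
  nlinarith

lemma continuous_ip_pt (v : CircleVec) : Continuous fun z : ℂ => ip v (pt z) := by
  simp only [ip_pt]; fun_prop

lemma isOpen_interstice (D A B C : CircleVec) : IsOpen (interstice D A B C) := by
  refine IsOpen.inter (isOpen_lt (continuous_ip_pt A) continuous_const) ?_
  refine IsOpen.inter (isOpen_lt (continuous_ip_pt B) continuous_const) ?_
  exact IsOpen.inter (isOpen_lt (continuous_ip_pt C) continuous_const)
    (isOpen_lt continuous_const (continuous_ip_pt D))

lemma interstice_subset (D A B C : CircleVec) :
    interstice D A B C ⊆ {w : ℂ | (w : RSphere) ∉ circ A ∪ circ B ∪ circ C} := by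
  rintro w ⟨h1, h2, h3, -⟩ ((h | h) | h)
  · exact h1.ne h
  · exact h2.ne h
  · exact h3.ne h

/-- If the component of `z` in the complement of the three circles lies in the strip, then `z` is
not on the unbounded side of the dual circle: a radial ray would lead it out of the strip. -/
lemma curvature_nonneg_of_bounded {D A B C : CircleVec} (h : IsDual D A B C) (hA : 0 ≤ A 0)
    (hB : 0 ≤ B 0) (hC : 0 ≤ C 0) {z : ℂ} (hz : z ∈ interstice D A B C)
    (hstrip : connectedComponentIn {w : ℂ | (w : RSphere) ∉ circ A ∪ circ B ∪ circ C} z ⊆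
      {w | 0 < w.im ∧ w.im < 1}) : 0 ≤ D 0 := by
  by_contra! h0
  have comp : ∀ s ⊆ interstice D A B C, IsPreconnected s → z ∈ s →
      s ⊆ {w | 0 < w.im ∧ w.im < 1} := fun s hs hc hzs =>
    (hc.subset_connectedComponentIn hzs (hs.trans (interstice_subset D A B C))).trans hstrip
  -- a point joined to `z` whose height differs from that of the centre
  obtain ⟨y, hyz, hy, him⟩ : ∃ y, JoinedIn (interstice D A B C) z y ∧ y ∈ interstice D A B C ∧
      y.im ≠ (centre D).im := by
    by_cases him : z.im = (centre D).im
    · obtain ⟨ε, hε, hball⟩ := Metric.isOpen_iff.mp (isOpen_interstice D A B C) z hz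
      have hmem : z + (ε / 2 : ℝ) * Complex.I ∈ Metric.ball z ε := by
        rw [Metric.mem_ball, dist_eq_norm, add_sub_cancel_left, norm_mul, Complex.norm_I, mul_one,
          Complex.norm_real, Real.norm_eq_abs, abs_of_pos (by linarith)]
        linarith
      refine ⟨_, JoinedIn.of_segment_subset (((convex_ball z ε).segment_subset
        (Metric.mem_ball_self hε) hmem).trans hball), hball hmem, ?_⟩
      simp [him, hε.ne']
    · exact ⟨z, JoinedIn.refl hz, hz, him⟩
  set u := y - centre D with hu
  have hyu : y = centre D + u := by rw [hu]; ring
  have huim : u.im ≠ 0 := by rw [hu]; simpa [sub_eq_zero] using him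
  -- the ray through it, far out
  set s : ℝ := 1 + (1 + |(centre D).im|) / |u.im| with hs
  have hpos : 0 < |u.im| := abs_pos.mpr huim
  have hs1 : 1 ≤ s := by rw [hs]; have : 0 ≤ (1 + |(centre D).im|) / |u.im| := by positivity
                         linarith
  have hj : JoinedIn (interstice D A B C) y (centre D + s * u) := by
    refine JoinedIn.of_segment_subset ?_
    rintro w ⟨a, b, ha, hb, hab, rfl⟩
    have e : a • y + b • (centre D + s * u) = centre D + ((a + b * s : ℝ) : ℂ) * u := by
      have : (a : ℂ) + b = 1 := by exact_mod_cast hab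
      simp only [Complex.real_smul, hyu]; push_cast
      linear_combination (centre D) * this
    rw [e]
    exact ray_mem_interstice h hA hB hC h0 (hyu ▸ hy) (by nlinarith)
  have hjz := hyz.trans hj
  have := comp _ (pathComponentIn_subset) (isPathConnected_pathComponentIn hz
    |>.isConnected.isPreconnected) (mem_pathComponentIn_self hz) hjz
  obtain ⟨l, r⟩ := this
  simp only [Complex.add_im, Complex.im_ofReal_mul] at l r
  have hsu : 1 + |(centre D).im| ≤ |s * u.im| := by
    rw [abs_mul, abs_of_pos (by linarith : 0 < s), hs, add_mul, div_mul_cancel₀ _ hpos.ne']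
    linarith
  have h1 := abs_le.mp (le_refl |(centre D).im|)
  rcases abs_cases (s * u.im) with ⟨e, -⟩ | ⟨e, -⟩ <;> rw [e] at hsu <;> linarith

/-- The inner interstice of three mutually tangent circles is connected. -/
lemma mem_connectedComponentIn_of_mem_interstice {D A B C : CircleVec} (h : IsDual D A B C)
    (hA : 0 ≤ A 0) (hB : 0 ≤ B 0) (hC : 0 ≤ C 0) (h0 : 0 ≤ D 0) {z e : ℂ}
    (hz : z ∈ interstice D A B C) (he : e ∈ interstice D A B C) :
    e ∈ connectedComponentIn {w : ℂ | (w : RSphere) ∉ circ A ∪ circ B ∪ circ C} z := by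
  have hj : JoinedIn (interstice D A B C) z e := by
    rcases h0.eq_or_lt with h0 | h0
    · exact joinedIn_interstice_of_eq_zero h hA hB hC h0.symm hz he
    · exact joinedIn_interstice_of_pos h hA hB hC h0 hz he
  exact (isPathConnected_pathComponentIn hz).isConnected.isPreconnected.subset_connectedComponentIn
    (mem_pathComponentIn_self hz) ((pathComponentIn_subset).trans (interstice_subset D A B C)) hj

/-! ### The circles and the mirrors of a Ford configuration -/

lemma ip_realVec_pt (z : ℂ) : ip realVec (pt z) = -z.im := by
  rw [ip_pt]; simp [realVec]

lemma ip_topVec_pt (z : ℂ) : ip topVec (pt z) = z.im - 1 := by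
  rw [ip_pt]; simp [topVec]

namespace FordConfiguration

variable (F : FordConfiguration)

/-- The coordinates of the circles of the initial configuration, each oriented such that its
interior is the disk or half plane of the configuration. -/
def vecs : Set CircleVec := {realVec, topVec} ∪ {v | ∃ p ∈ F.disks, v = diskVec p.1 p.2}

lemma realVec_mem : realVec ∈ F.vecs := Or.inl (Or.inl rfl)

lemma topVec_mem : topVec ∈ F.vecs := Or.inl (Or.inr rfl)

lemma diskVec_mem {p : ℂ × ℝ} (hp : p ∈ F.disks) : diskVec p.1 p.2 ∈ F.vecs := Or.inr ⟨p, hp, rfl⟩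

lemma vecs_cases {P : CircleVec → Prop} (hreal : P realVec) (htop : P topVec)
    (hdisk : ∀ p ∈ F.disks, P (diskVec p.1 p.2)) : ∀ k ∈ F.vecs, P k := by
  rintro k ((rfl | rfl) | ⟨p, hp, rfl⟩)
  exacts [hreal, htop, hdisk p hp]

lemma exists_vec_of_mem_initial {C : Set RSphere} (h : C ∈ F.initial) :
    ∃ k ∈ F.vecs, C = circ k := by
  rcases h with (rfl | rfl) | ⟨p, hp, rfl⟩
  · exact ⟨_, F.realVec_mem, circ_realVec.symm⟩
  · exact ⟨_, F.topVec_mem, circ_topVec.symm⟩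
  · exact ⟨_, F.diskVec_mem hp, (circ_diskVec _ (F.radius_pos p hp)).symm⟩

lemma circ_mem_initial : ∀ k ∈ F.vecs, circ k ∈ F.initial :=
  F.vecs_cases (Or.inl (Or.inl circ_realVec)) (Or.inl (Or.inr circ_topVec))
    fun p hp => Or.inr ⟨p, hp, circ_diskVec _ (F.radius_pos p hp)⟩

lemma ip_self_of_mem : ∀ k ∈ F.vecs, ip k k = 1 :=
  F.vecs_cases (by simp [ip, realVec]) (by simp [ip, topVec])
    fun p hp => ip_diskVec_self _ (F.radius_pos p hp)

lemma curvature_nonneg : ∀ k ∈ F.vecs, 0 ≤ k 0 :=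
  F.vecs_cases (by simp [realVec]) (by simp [topVec])
    fun p hp => by simp [diskVec, (F.radius_pos p hp).le]

lemma ip_realVec_diskVec_le {p : ℂ × ℝ} (hp : p ∈ F.disks) :
    ip realVec (diskVec p.1 p.2) ≤ -1 := by
  have hr := F.radius_pos p hp
  have e : ip realVec (diskVec p.1 p.2) = -(p.1.im / p.2) := by simp [ip, realVec, diskVec]
  have := (one_le_div hr).mpr (F.in_strip p hp).1
  rw [e]; linarith

lemma ip_topVec_diskVec_le {p : ℂ × ℝ} (hp : p ∈ F.disks) :
    ip topVec (diskVec p.1 p.2) ≤ -1 := by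
  have hr := F.radius_pos p hp
  have e : ip topVec (diskVec p.1 p.2) = -((1 - p.1.im) / p.2) := by
    simp [ip, topVec, diskVec]; ring
  have := (one_le_div hr).mpr (show p.2 ≤ 1 - p.1.im by linarith [(F.in_strip p hp).2])
  rw [e]; linarith

lemma ip_diskVec_diskVec_le {p q : ℂ × ℝ} (hp : p ∈ F.disks) (hq : q ∈ F.disks) (hpq : p ≠ q) :
    ip (diskVec p.1 p.2) (diskVec q.1 q.2) ≤ -1 := by
  have hr := F.radius_pos p hp
  have hs := F.radius_pos q hq
  have hd := F.disjoint_interiors p hp q hq hpq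
  have e : ip (diskVec p.1 p.2) (diskVec q.1 q.2) =
      (p.2 ^ 2 + q.2 ^ 2 - dist p.1 q.1 ^ 2) / (2 * p.2 * q.2) := by
    rw [dist_eq_norm, sq_norm_eq]
    simp [ip, diskVec]; field_simp; ring
  rw [e, div_le_iff₀ (by positivity)]
  nlinarith

lemma ip_le_of_ne : ∀ k ∈ F.vecs, ∀ k' ∈ F.vecs, k ≠ k' → ip k k' ≤ -1 := by
  have rt : ip realVec topVec = -1 := by simp [ip, realVec, topVec]
  refine F.vecs_cases ?_ ?_ fun p hp => ?_
  · exact F.vecs_cases (fun h => absurd rfl h) (fun _ => rt.le)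
      fun p hp _ => F.ip_realVec_diskVec_le hp
  · exact F.vecs_cases (fun _ => by rw [ip_comm]; exact rt.le) (fun h => absurd rfl h)
      fun p hp _ => F.ip_topVec_diskVec_le hp
  · refine F.vecs_cases (fun _ => ?_) (fun _ => ?_) fun q hq hne => ?_
    · rw [ip_comm]; exact F.ip_realVec_diskVec_le hp
    · rw [ip_comm]; exact F.ip_topVec_diskVec_le hp
    · exact F.ip_diskVec_diskVec_le hp hq (by rintro rfl; exact hne rfl)

lemma ip_pt_neg_of_mem_gapRegion {z : ℂ} (hz : z ∈ gapRegion F.disks) :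
    ∀ k ∈ F.vecs, ip k (pt z) < 0 := by
  obtain ⟨h1, h2, h3⟩ := hz
  refine F.vecs_cases ?_ ?_ fun p hp => ?_
  · rw [ip_realVec_pt]; linarith
  · rw [ip_topVec_pt]; linarith
  · have hr := F.radius_pos p hp
    rw [ip_diskVec_pt _ hr, div_neg_iff]
    right
    exact ⟨by nlinarith [h3 p hp], by linarith⟩

/-- Every disk of the configuration has a point that lies outside all the others. -/
lemma exists_interior_point :
    ∀ k ∈ F.vecs, ∃ e : ℂ, 0 < ip k (pt e) ∧ ∀ k' ∈ F.vecs, k' ≠ k → ip k' (pt e) < 0 := by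
  have far : ∀ p ∈ F.disks, ∀ e : ℂ, p.2 < dist e p.1 → ip (diskVec p.1 p.2) (pt e) < 0 := by
    intro p hp e he
    have hr := F.radius_pos p hp
    rw [ip_diskVec_pt _ hr, div_neg_iff]
    right
    exact ⟨by nlinarith, by linarith⟩
  have him : ∀ e c : ℂ, |e.im - c.im| ≤ dist e c := by
    intro e c
    rw [dist_eq_norm, ← Complex.sub_im]
    exact Complex.abs_im_le_norm _
  refine F.vecs_cases ?_ ?_ fun p hp => ?_
  · refine ⟨-Complex.I, by rw [ip_realVec_pt]; simp, ?_⟩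
    refine F.vecs_cases (fun h => absurd rfl h) (fun _ => by rw [ip_topVec_pt]; simp)
      fun p hp _ => far p hp _ ?_
    have h1 := him (-Complex.I) p.1
    have h2 := neg_le_abs ((-Complex.I).im - p.1.im)
    have h3 := (F.in_strip p hp).1
    simp at h1 h2
    linarith
  · refine ⟨2 * Complex.I, by rw [ip_topVec_pt]; simp, ?_⟩
    refine F.vecs_cases (fun _ => by rw [ip_realVec_pt]; simp) (fun h => absurd rfl h)
      fun p hp _ => far p hp _ ?_
    have h1 := him (2 * Complex.I) p.1
    have h2 := le_abs_self ((2 * Complex.I).im - p.1.im)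
    have h3 := (F.in_strip p hp).2
    simp at h1 h2
    linarith
  · have hr := F.radius_pos p hp
    have hs := F.in_strip p hp
    refine ⟨p.1, by rw [ip_diskVec_pt _ hr, dist_self]; simp; positivity, ?_⟩
    refine F.vecs_cases (fun _ => by rw [ip_realVec_pt]; linarith)
      (fun _ => by rw [ip_topVec_pt]; linarith) fun q hq hne => far q hq _ ?_
    have := F.disjoint_interiors p hp q hq (by rintro rfl; exact hne rfl)
    linarith

lemma circ_ne_singleton : ∀ k ∈ F.vecs, ∀ z, circ k ≠ {z} := by
  have two : ∀ (k : CircleVec) (x y z : RSphere), x ≠ y → x ∈ circ k → y ∈ circ k →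
      circ k ≠ {z} := by
    intro k x y z hne hx hy e
    rw [e] at hx hy
    exact hne (hx.trans hy.symm)
  refine F.vecs_cases (fun z => ?_) (fun z => ?_) fun p hp z => ?_
  · refine two _ OnePoint.infty ((0 : ℂ) : RSphere) z (OnePoint.infty_ne_coe _) ?_ ?_
    · rw [mem_circ, lift_infty, ip_ptInfty]; simp [realVec]
    · rw [mem_circ, lift_coe, ip_realVec_pt]; simp
  · refine two _ OnePoint.infty (Complex.I : RSphere) z (OnePoint.infty_ne_coe _) ?_ ?_
    · rw [mem_circ, lift_infty, ip_ptInfty]; simp [topVec]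
    · rw [mem_circ, lift_coe, ip_topVec_pt]; simp
  · have hr := F.radius_pos p hp
    refine two _ ((p.1 + p.2 : ℂ) : RSphere) ((p.1 - p.2 : ℂ) : RSphere) z ?_ ?_ ?_
    · rw [Ne, OnePoint.coe_eq_coe]
      intro e
      have := congrArg Complex.re e
      simp at this
      linarith
    · rw [mem_circ, lift_coe, ip_diskVec_pt _ hr]; simp [dist_eq_norm]
    · rw [mem_circ, lift_coe, ip_diskVec_pt _ hr]; simp

/-- Tangent circles of the configuration have inner product `-1`. -/
lemma ip_eq_of_tangent {a b : CircleVec} (ha : a ∈ F.vecs) (hb : b ∈ F.vecs)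
    (h : Tangent (circ a) (circ b)) : ip a b = -1 := by
  obtain ⟨z, hz⟩ := h
  by_cases e : a = b
  · subst e
    rw [Set.inter_self] at hz
    exact absurd hz (F.circ_ne_singleton a ha z)
  · have hle := F.ip_le_of_ne a ha b hb e
    have hmem : z ∈ circ a ∩ circ b := hz ▸ rfl
    have := sq_ip_le_one_of_mem (F.ip_self_of_mem a ha) (F.ip_self_of_mem b hb) hmem.1 hmem.2
    nlinarith

/-- `D` is the dual circle of the gap bounded by `A`, `B`, `C`, oriented such that the gap lies in
its interior, and `S` is the reflection in it. -/
structure IsMirrorOf (D A B C : CircleVec) (S : Equiv.Perm RSphere) : Prop where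
  memA : A ∈ F.vecs
  memB : B ∈ F.vecs
  memC : C ∈ F.vecs
  dual : IsDual D A B C
  curvature_nonneg : 0 ≤ D 0
  gap : F.IsGapReflection (circ A) (circ B) (circ C) S
  smul_circ : ∀ w, S • circ w = circ (refl D w)
  side : ∀ E ∈ F.vecs, E ≠ A → E ≠ B → E ≠ C → ip E D ≤ -2

/-- The oriented dual circles of the gaps. -/
def mirrors : Set CircleVec := {D | ∃ A B C S, F.IsMirrorOf D A B C S}

variable {F}

/-- The dual circle of a gap, oriented towards the gap, has every other circle of the
configuration outside. Otherwise the gap, being a whole interstice of `A`, `B`, `C`, would contain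
points of a disk. -/
lemma IsGapReflection.exists_mirror {A' B' C' : Set RSphere} {S : Equiv.Perm RSphere}
    (h : F.IsGapReflection A' B' C' S) :
    ∃ D A B C, F.IsMirrorOf D A B C S ∧ A' = circ A ∧ B' = circ B ∧ C' = circ C := by
  obtain ⟨⟨z, hz⟩, D', hS, hAB, hBC, hAC⟩ := id h
  obtain ⟨hzg, mA, mB, mC, tAB, tBC, tAC, hcomp⟩ := hz
  obtain ⟨A, hA, rfl⟩ := F.exists_vec_of_mem_initial mA
  obtain ⟨B, hB, rfl⟩ := F.exists_vec_of_mem_initial mB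
  obtain ⟨C, hC, rfl⟩ := F.exists_vec_of_mem_initial mC
  obtain ⟨v, hv, rfl, hact⟩ := hS.exists_vec
  have uA := F.ip_self_of_mem A hA
  have uB := F.ip_self_of_mem B hB
  have uC := F.ip_self_of_mem C hC
  have iAB := F.ip_eq_of_tangent hA hB tAB
  have iBC := F.ip_eq_of_tangent hB hC tBC
  have iAC := F.ip_eq_of_tangent hA hC tAC
  have sAB := ip_add_ip_eq_zero uA uB iAB hAB
  have sBC := ip_add_ip_eq_zero uB uC iBC hBC
  have sAC := ip_add_ip_eq_zero uA uC iAC hAC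
  have dual : IsDual v A B C :=
    ⟨uA, uB, uC, iAB, iBC, iAC, hv, by linarith, by linarith, by linarith⟩
  have out := F.ip_pt_neg_of_mem_gapRegion hzg
  have oA := out A hA
  have oB := out B hB
  have oC := out C hC
  have hne : ip v (pt z) ≠ 0 := by
    intro h0
    have := dual.ip_eq (pt z) (pt z)
    rw [ip_pt_pt, ip_comm _ v, ip_comm _ A, ip_comm _ B, ip_comm _ C, h0] at this
    nlinarith [mul_pos_of_neg_of_neg oA oB, mul_pos_of_neg_of_neg oB oC,
      mul_pos_of_neg_of_neg oA oC]
  -- orient the dual circle towards the gap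
  obtain ⟨D, hD, hactD, hpos⟩ : ∃ D, IsDual D A B C ∧ (∀ w, S • circ w = circ (refl D w)) ∧
      0 < ip D (pt z) := by
    rcases hne.lt_or_gt with hlt | hgt
    · exact ⟨-v, dual.neg, fun w => by rw [hact, refl_neg], by rw [ip_neg_left]; linarith⟩
    · exact ⟨v, dual, hact, hgt⟩
  have zin : z ∈ interstice D A B C := ⟨oA, oB, oC, hpos⟩
  have cA := F.curvature_nonneg A hA
  have cB := F.curvature_nonneg B hB
  have cC := F.curvature_nonneg C hC
  have hsub := hcomp ▸ connectedComponentIn_subset (gapRegion F.disks) z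
  have hD0 := curvature_nonneg_of_bounded hD cA cB cC zin fun w hw =>
    ⟨(hsub hw).1, (hsub hw).2.1⟩
  refine ⟨D, A, B, C, ⟨hA, hB, hC, hD, hD0, h, hactD, ?_⟩, rfl, rfl, rfl⟩
  intro E hE nA nB nC
  have a := F.ip_le_of_ne E hE A hA nA
  have b := F.ip_le_of_ne E hE B hB nB
  have c := F.ip_le_of_ne E hE C hC nC
  have e4 : 4 ≤ ip E D ^ 2 := by
    have := hD.ip_eq E E
    rw [F.ip_self_of_mem E hE] at this
    nlinarith
  by_contra! hgt
  have hEpos : 0 < ip E D := by nlinarith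
  obtain ⟨e, hin, hout⟩ := F.exists_interior_point E hE
  have eA := hout A hA nA.symm
  have eB := hout B hB nB.symm
  have eC := hout C hC nC.symm
  have eD : 0 < ip D (pt e) := by
    have := hD.ip_eq E (pt e)
    rw [ip_comm (pt e) D, ip_comm (pt e) A, ip_comm (pt e) B, ip_comm (pt e) C] at this
    have k1 : 0 < ip E A * (ip B (pt e) + ip C (pt e)) :=
      mul_pos_of_neg_of_neg (by linarith) (by linarith)
    have k2 : 0 < ip E B * (ip A (pt e) + ip C (pt e)) :=
      mul_pos_of_neg_of_neg (by linarith) (by linarith)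
    have k3 : 0 < ip E C * (ip A (pt e) + ip B (pt e)) :=
      mul_pos_of_neg_of_neg (by linarith) (by linarith)
    have : 0 < ip E D * ip D (pt e) := by linarith
    exact pos_of_mul_pos_right this hEpos.le
  have := hsub (mem_connectedComponentIn_of_mem_interstice hD cA cB cC hD0 zin ⟨eA, eB, eC, eD⟩)
  linarith [F.ip_pt_neg_of_mem_gapRegion this E hE]

/-- No mirror is orthogonal to all circles of the configuration. -/
lemma exists_ip_ne_zero {D : CircleVec} (hD : ip D D = 1) : ∃ k ∈ F.vecs, ip k D ≠ 0 := by
  by_contra! h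
  have h1 := h _ F.realVec_mem
  have h2 := h _ F.topVec_mem
  have h3 := h _ (F.diskVec_mem F.first_mem)
  have h4 := h _ (F.diskVec_mem F.last_mem)
  have ht := F.two_le_t
  simp [ip, realVec, topVec, diskVec] at h1 h2 h3 h4
  have d0 : D 0 = 0 := by rw [h1] at h2; linarith
  rw [h1] at h3
  rw [h1, d0] at h4
  have d3 : D 3 = 0 := by linarith
  rw [d3] at h4
  have d1 : D 1 = 0 := by
    have : F.t * D 1 = 0 := by linarith
    rcases mul_eq_zero.mp this with h | h
    · linarith
    · exact h
  simp [ip, h1, d0, d1] at hD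

namespace IsMirrorOf

variable {D A B C : CircleVec} {S : Equiv.Perm RSphere}

lemma mem_mirrors (h : F.IsMirrorOf D A B C S) : D ∈ F.mirrors := ⟨A, B, C, S, h⟩

lemma ip_eq_zero_or (h : F.IsMirrorOf D A B C S) {k : CircleVec} (hk : k ∈ F.vecs) :
    ip k D = 0 ∨ ip k D ≤ -2 := by
  by_cases hA : k = A
  · left; rw [hA, ip_comm, h.dual.da]
  by_cases hB : k = B
  · left; rw [hB, ip_comm, h.dual.db]
  by_cases hC : k = C
  · left; rw [hC, ip_comm, h.dual.dc]
  exact Or.inr (h.side k hk hA hB hC)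

/-- Only the three circles that bound a gap are orthogonal to its mirror. -/
lemma eq_of_ip_eq_zero (h : F.IsMirrorOf D A B C S) {k : CircleVec} (hk : k ∈ F.vecs)
    (h0 : ip k D = 0) : k = A ∨ k = B ∨ k = C := by
  by_contra! hne
  linarith [h.side k hk hne.1 hne.2.1 hne.2.2]

/-- Two mirrors that are orthogonal to the same three circles agree: both interstices of three
circles cannot be gaps. -/
lemma eq_of_isDual {D' A' B' C' : CircleVec} {S' : Equiv.Perm RSphere}
    (h : F.IsMirrorOf D A B C S) (h' : F.IsMirrorOf D' A' B' C' S') {X Y Z : CircleVec}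
    (hd : IsDual D X Y Z) (hd' : IsDual D' X Y Z) : D' = D := by
  rcases hd.eq_or_eq_neg hd' with e | e
  · exact e
  · exfalso
    obtain ⟨k, hk, hne⟩ := exists_ip_ne_zero (F := F) h.dual.dd
    have h1 := h.ip_eq_zero_or hk
    have h2 := h'.ip_eq_zero_or hk
    rw [e, ip_neg_right] at h2
    rcases h1 with h1 | h1
    · exact hne h1
    · rcases h2 with h2 | h2 <;> linarith

/-- Different mirrors have disjoint interiors. -/
lemma ip_le {D' A' B' C' : CircleVec} {S' : Equiv.Perm RSphere}
    (h : F.IsMirrorOf D A B C S) (h' : F.IsMirrorOf D' A' B' C' S') (hne : D ≠ D') :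
    ip D D' ≤ -1 := by
  have nonpos : ∀ k ∈ F.vecs, ip D' k ≤ 0 := fun k hk => by
    rw [ip_comm]; rcases h'.ip_eq_zero_or hk with e | e <;> linarith
  have a := nonpos A h.memA
  have b := nonpos B h.memB
  have c := nonpos C h.memC
  have sq : 1 ≤ ip D' D ^ 2 := by
    have := h.dual.ip_eq D' D'
    rw [h'.dual.dd] at this
    nlinarith [mul_nonneg_of_nonpos_of_nonpos a b, mul_nonneg_of_nonpos_of_nonpos b c,
      mul_nonneg_of_nonpos_of_nonpos a c]
  rw [ip_comm]
  by_contra! hgt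
  have hw : 1 ≤ ip D' D := by nlinarith
  -- otherwise the mirrors are nested, and each circle around the second gap bounds the first
  have orth : ∀ X ∈ F.vecs, ip D' X = 0 → ip D X = 0 := by
    intro X hX h0
    rcases h.ip_eq_zero_or hX with e | e
    · rw [ip_comm, e]
    · exfalso
      have nA : X ≠ A := by rintro rfl; rw [ip_comm, h.dual.da] at e; linarith
      have nB : X ≠ B := by rintro rfl; rw [ip_comm, h.dual.db] at e; linarith
      have nC : X ≠ C := by rintro rfl; rw [ip_comm, h.dual.dc] at e; linarith
      have xA := F.ip_le_of_ne X hX A h.memA nA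
      have xB := F.ip_le_of_ne X hX B h.memB nB
      have xC := F.ip_le_of_ne X hX C h.memC nC
      have := h.dual.ip_eq X D'
      rw [ip_comm X D', h0] at this
      have k1 : 0 ≤ ip X A * (ip D' B + ip D' C) :=
        mul_nonneg_of_nonpos_of_nonpos (by linarith) (by linarith)
      have k2 : 0 ≤ ip X B * (ip D' A + ip D' C) :=
        mul_nonneg_of_nonpos_of_nonpos (by linarith) (by linarith)
      have k3 : 0 ≤ ip X C * (ip D' A + ip D' B) :=
        mul_nonneg_of_nonpos_of_nonpos (by linarith) (by linarith)
      nlinarith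
  refine hne (h.eq_of_isDual h' (X := A') (Y := B') (Z := C') ?_ h'.dual).symm
  exact { h'.dual with
    dd := h.dual.dd
    da := orth A' h'.memA h'.dual.da
    db := orth B' h'.memB h'.dual.db
    dc := orth C' h'.memC h'.dual.dc }

end IsMirrorOf

variable (F)

lemma mirrorSystem : MirrorSystem F.vecs F.mirrors where
  ip_self := F.ip_self_of_mem
  ip_le := F.ip_le_of_ne
  mirror_self := fun _ ⟨_, _, _, _, h⟩ => h.dual.dd
  mirror_le := fun _ ⟨_, _, _, _, h⟩ _ ⟨_, _, _, _, h'⟩ => h.ip_le h'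
  side := fun _ hk _ ⟨_, _, _, _, h⟩ => h.ip_eq_zero_or hk

lemma exists_third (a b : CircleVec) : ∃ c ∈ F.vecs, c ≠ a ∧ c ≠ b := by
  have rt : realVec ≠ topVec := fun h => by
    have := congrFun h 3; simp [realVec, topVec] at this
  have d0 : diskVec (Complex.I / 2) (1 / 2) 0 = 2 := by simp [diskVec]
  have rd : realVec ≠ diskVec (Complex.I / 2) (1 / 2) := fun h => by
    have := congrFun h 0; rw [d0] at this; simp [realVec] at this
  have td : topVec ≠ diskVec (Complex.I / 2) (1 / 2) := fun h => by
    have := congrFun h 0; rw [d0] at this; simp [topVec] at this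
  by_cases h1 : realVec ≠ a ∧ realVec ≠ b
  · exact ⟨_, F.realVec_mem, h1⟩
  by_cases h2 : topVec ≠ a ∧ topVec ≠ b
  · exact ⟨_, F.topVec_mem, h2⟩
  refine ⟨_, F.diskVec_mem F.first_mem, ?_, ?_⟩
  · rintro rfl
    have e1 : realVec = b := by by_contra e; exact h1 ⟨rd, e⟩
    have e2 : topVec = b := by by_contra e; exact h2 ⟨td, e⟩
    exact rt (e1.trans e2.symm)
  · rintro rfl
    have e1 : realVec = a := by by_contra e; exact h1 ⟨e, rd⟩
    have e2 : topVec = a := by by_contra e; exact h2 ⟨e, td⟩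
    exact rt (e1.trans e2.symm)

end FordConfiguration

/-! ### The reflection group -/

lemma Tangent.smul {A B : Set RSphere} (h : Tangent A B) (g : Equiv.Perm RSphere) :
    Tangent (g • A) (g • B) := by
  obtain ⟨p, hp⟩ := h
  exact ⟨g p, by rw [← Set.smul_set_inter, hp, Set.smul_set_singleton]; rfl⟩

lemma Tangent.symm {A B : Set RSphere} (h : Tangent A B) : Tangent B A := by
  obtain ⟨p, hp⟩ := h
  exact ⟨p, by rw [Set.inter_comm, hp]⟩

lemma eq_of_smul_circ_eq {g g' : Equiv.Perm RSphere} (h : ∀ v, g • circ v = g' • circ v) :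
    g = g' := by
  have : g'⁻¹ * g = 1 := eq_one_of_smul_circ fun v _ => by
    rw [mul_smul, h, inv_smul_smul]
  exact (inv_mul_eq_one.mp this).symm

lemma IsDual.swap {D A B C : CircleVec} (h : IsDual D A B C) : IsDual D B A C :=
  ⟨h.bb, h.aa, h.cc, by rw [ip_comm, h.ab], h.ac, h.bc, h.dd, h.db, h.da, h.dc⟩

lemma IsDual.rotate {D A B C : CircleVec} (h : IsDual D A B C) : IsDual D B C A :=
  ⟨h.bb, h.cc, h.aa, h.bc, by rw [ip_comm, h.ac], by rw [ip_comm, h.ab], h.dd, h.db, h.dc, h.da⟩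

lemma IsTriangularGap.swap {disks : Finset (ℂ × ℝ)} {z : ℂ} {A B C : Set RSphere}
    (h : IsTriangularGap disks z A B C) : IsTriangularGap disks z B A C := by
  obtain ⟨hz, hA, hB, hC, ab, bc, ac, e⟩ := h
  exact ⟨hz, hB, hA, hC, ab.symm, ac, bc, by rw [e, Set.union_comm A B]⟩

lemma IsTriangularGap.rotate {disks : Finset (ℂ × ℝ)} {z : ℂ} {A B C : Set RSphere}
    (h : IsTriangularGap disks z A B C) : IsTriangularGap disks z B C A := by
  obtain ⟨hz, hA, hB, hC, ab, bc, ac, e⟩ := h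
  exact ⟨hz, hB, hC, hA, bc, ac.symm, ab.symm, by rw [e, Set.union_assoc, Set.union_comm]⟩

namespace FordConfiguration

variable {F : FordConfiguration}

lemma IsGapReflection.swap {A B C : Set RSphere} {S : Equiv.Perm RSphere}
    (h : F.IsGapReflection A B C S) : F.IsGapReflection B A C S := by
  obtain ⟨⟨z, hz⟩, D, hD, ab, bc, ac⟩ := h
  exact ⟨⟨z, hz.swap⟩, D, hD, by rwa [Set.inter_comm], ac, bc⟩

lemma IsGapReflection.rotate {A B C : Set RSphere} {S : Equiv.Perm RSphere}
    (h : F.IsGapReflection A B C S) : F.IsGapReflection B C A S := by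
  obtain ⟨⟨z, hz⟩, D, hD, ab, bc, ac⟩ := h
  exact ⟨⟨z, hz.rotate⟩, D, hD, bc, by rwa [Set.inter_comm], by rwa [Set.inter_comm]⟩

namespace IsMirrorOf

variable {D A B C : CircleVec} {S : Equiv.Perm RSphere}

lemma swap (h : F.IsMirrorOf D A B C S) : F.IsMirrorOf D B A C S :=
  ⟨h.memB, h.memA, h.memC, h.dual.swap, h.curvature_nonneg, h.gap.swap, h.smul_circ,
    fun E hE hB hA hC => h.side E hE hA hB hC⟩

lemma rotate (h : F.IsMirrorOf D A B C S) : F.IsMirrorOf D B C A S :=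
  ⟨h.memB, h.memC, h.memA, h.dual.rotate, h.curvature_nonneg, h.gap.rotate, h.smul_circ,
    fun E hE hB hC hA => h.side E hE hA hB hC⟩

lemma exists_of_ip_eq_zero (h : F.IsMirrorOf D A B C S) {k : CircleVec} (hk : k ∈ F.vecs)
    (h0 : ip k D = 0) : ∃ X Y, F.IsMirrorOf D X Y k S := by
  rcases h.eq_of_ip_eq_zero hk h0 with rfl | rfl | rfl
  · exact ⟨_, _, h.rotate⟩
  · exact ⟨_, _, h.rotate.rotate⟩
  · exact ⟨_, _, h⟩

lemma of_ip_eq_zero (h : F.IsMirrorOf D A B C S) {x y k : CircleVec} (hx : x ∈ F.vecs)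
    (hy : y ∈ F.vecs) (hk : k ∈ F.vecs) (hxy : x ≠ y) (hxk : x ≠ k) (hyk : y ≠ k)
    (x0 : ip x D = 0) (y0 : ip y D = 0) (k0 : ip k D = 0) : F.IsMirrorOf D x y k S := by
  obtain ⟨X, Y, h⟩ := h.exists_of_ip_eq_zero hk k0
  rcases h.eq_of_ip_eq_zero hx x0 with rfl | rfl | rfl
  · rcases h.eq_of_ip_eq_zero hy y0 with rfl | rfl | rfl
    · exact absurd rfl hxy
    · exact h
    · exact absurd rfl hyk
  · rcases h.eq_of_ip_eq_zero hy y0 with rfl | rfl | rfl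
    · exact h.swap
    · exact absurd rfl hxy
    · exact absurd rfl hyk
  · exact absurd rfl hxk

lemma tangent (h : F.IsMirrorOf D A B C S) : Tangent (circ A) (circ B) := by
  obtain ⟨⟨z, hz⟩, -⟩ := h.gap
  exact hz.2.2.2.2.1

lemma mem_reflectionGroup (h : F.IsMirrorOf D A B C S) : S ∈ F.reflectionGroup :=
  Subgroup.subset_closure ⟨_, _, _, h.gap⟩

lemma ip_ptInfty_nonpos (h : F.IsMirrorOf D A B C S) : ip D ptInfty ≤ 0 := by
  rw [ip_ptInfty]; linarith [h.curvature_nonneg]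

end IsMirrorOf

variable (F)

lemma circ_injOn : Set.InjOn circ F.vecs := by
  intro k hk k' hk' e
  rcases eq_or_eq_neg_of_circ_eq (F.ip_self_of_mem k hk) (F.ip_self_of_mem k' hk') e with e | e
  · exact e
  · exfalso
    obtain ⟨c, hc, h1, h2⟩ := F.exists_third k k'
    have a := F.ip_le_of_ne k hk c hc h1.symm
    have b := F.ip_le_of_ne k' hk' c hc h2.symm
    rw [e, ip_neg_left] at a
    linarith

/-- Every element of the reflection group acts on circles as a reduced word in the mirrors. -/
lemma exists_word {g : Equiv.Perm RSphere} (hg : g ∈ F.reflectionGroup) :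
    ∃ l : List CircleVec, (∀ D ∈ l, D ∈ F.mirrors) ∧ l.IsChain (· ≠ ·) ∧
      ∀ v, g • circ v = circ (word l v) := by
  have unit : ∀ l : List CircleVec, (∀ D ∈ l, D ∈ F.mirrors) → ∀ D ∈ l, ip D D = 1 :=
    fun l hl D hD => F.mirrorSystem.mirror_self D (hl D hD)
  suffices h : ∃ l : List CircleVec, (∀ D ∈ l, D ∈ F.mirrors) ∧
      ∀ v, g • circ v = circ (word l v) by
    obtain ⟨l, hl, hact⟩ := h
    obtain ⟨m, hm, hc, hw⟩ := exists_reduced_word (unit l hl)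
    exact ⟨m, fun D hD => hl D (hm D hD), hc, fun v => by rw [hact, hw]⟩
  induction hg using Subgroup.closure_induction with
  | mem S hS =>
    obtain ⟨A', B', C', hS⟩ := hS
    obtain ⟨D, A, B, C, hD, -⟩ := hS.exists_mirror
    exact ⟨[D], by simpa using hD.mem_mirrors, fun v => by
      rw [hD.smul_circ, word_cons, word_nil]⟩
  | one => exact ⟨[], by simp, fun v => by simp⟩
  | mul g g' _ _ ih ih' =>
    obtain ⟨l, hl, e⟩ := ih
    obtain ⟨l', hl', e'⟩ := ih'
    refine ⟨l ++ l', fun D hD => ?_, fun v => by rw [mul_smul, e', e, word_append]⟩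
    exact (List.mem_append.mp hD).elim (hl D) (hl' D)
  | inv g _ ih =>
    obtain ⟨l, hl, e⟩ := ih
    have hl' : ∀ D ∈ l.reverse, D ∈ F.mirrors := fun D hD => hl D (List.mem_reverse.mp hD)
    refine ⟨l.reverse, hl', fun v => ?_⟩
    rw [inv_smul_eq_iff, e]
    have := word_reverse_word (unit _ hl') v
    rw [List.reverse_reverse] at this
    rw [this]

/-- The mirrors of the gaps along the real axis. -/
def realMirrors : Set CircleVec := {D | D ∈ F.mirrors ∧ ip realVec D = 0}

variable {F}

lemma ip_self_of_mem_realMirrors {l : List CircleVec} (hl : ∀ D ∈ l, D ∈ F.realMirrors) :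
    ∀ D ∈ l, ip D D = 1 := fun D hD => F.mirrorSystem.mirror_self D (hl D hD).1

lemma mem_Gamma₀_iff {g : Equiv.Perm RSphere} :
    g ∈ F.Gamma₀ ↔ g ∈ F.reflectionGroup ∧ g • realLine = realLine := by
  rw [Gamma₀, Subgroup.mem_inf, MulAction.mem_stabilizer_iff]

lemma word_realVec {l : List CircleVec} (hl : ∀ D ∈ l, D ∈ F.realMirrors) :
    word l realVec = realVec := word_eq_self fun D hD => (hl D hD).2

lemma ip_word_realVec {l : List CircleVec} (hl : ∀ D ∈ l, D ∈ F.realMirrors) (v : CircleVec) :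
    ip (word l v) realVec = ip v realVec := by
  have := ip_word_word (ip_self_of_mem_realMirrors hl) v realVec
  rwa [word_realVec hl] at this

/-- Words in the mirrors along the real axis come from elements of the stabilizer of the real
axis. -/
lemma exists_mem_Gamma₀ {l : List CircleVec} (hl : ∀ D ∈ l, D ∈ F.realMirrors) :
    ∃ g ∈ F.Gamma₀, ∀ v, g • circ v = circ (word l v) := by
  induction l with
  | nil => exact ⟨1, one_mem _, fun v => by simp⟩
  | cons D l ih =>
    obtain ⟨g, hg, e⟩ := ih fun E hE => hl E (List.mem_cons_of_mem _ hE)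
    obtain ⟨⟨A, B, C, S, hD⟩, h0⟩ := hl D List.mem_cons_self
    have hS : S ∈ F.Gamma₀ := mem_Gamma₀_iff.mpr ⟨hD.mem_reflectionGroup, by
      rw [← circ_realVec, hD.smul_circ, refl_eq_self h0]⟩
    exact ⟨S * g, mul_mem hS hg, fun v => by rw [mul_smul, e, hD.smul_circ, word_cons]⟩

lemma circ_mem_initial₀ {k : CircleVec} (hk : k ∈ F.vecs) (ht : Tangent (circ k) realLine) :
    circ k ∈ F.initial₀ :=
  ⟨F.circ_mem_initial k hk, ⟨1, one_mem _, _, F.circ_mem_initial k hk, by simp⟩, ht⟩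

lemma tangent_smul_iff {g : Equiv.Perm RSphere} (hg : g ∈ F.Gamma₀) {A : Set RSphere} :
    Tangent (g • A) realLine ↔ Tangent A realLine := by
  have key : ∀ h ∈ F.Gamma₀, ∀ B : Set RSphere, Tangent B realLine → Tangent (h • B) realLine := by
    intro h hh B hB
    have := hB.smul h
    rwa [(mem_Gamma₀_iff.mp hh).2] at this
  refine ⟨fun h => ?_, key g hg A⟩
  have := key g⁻¹ (inv_mem hg) _ h
  rwa [inv_smul_smul] at this

lemma smul_mem_packing₀ {g : Equiv.Perm RSphere} (hg : g ∈ F.Gamma₀) {k : CircleVec}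
    (hk : k ∈ F.vecs) (ht : Tangent (circ k) realLine) : g • circ k ∈ F.packing₀ :=
  ⟨⟨g, (mem_Gamma₀_iff.mp hg).1, _, F.circ_mem_initial k hk, rfl⟩, (tangent_smul_iff hg).mpr ht⟩

/-- A circle of the packing that touches the real axis is the image of an initial circle under
reflections in mirrors along the real axis. -/
lemma exists_word_of_mem_packing₀ {C : Set RSphere} (hC : C ∈ F.packing₀) :
    ∃ l : List CircleVec, (∀ D ∈ l, D ∈ F.realMirrors) ∧ ∃ v ∈ F.vecs, C = circ (word l v) ∧
      ip v realVec = -1 ∧ Tangent (circ v) realLine := by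
  obtain ⟨⟨g, hg, A, hA, rfl⟩, ht⟩ := hC
  obtain ⟨v, hv, rfl⟩ := F.exists_vec_of_mem_initial hA
  obtain ⟨l, hl, hc, e⟩ := F.exists_word hg
  have hunit := ip_word_word (fun D hD => F.mirrorSystem.mirror_self D (hl D hD)) v v
  rw [F.ip_self_of_mem v hv] at hunit
  have ht' := ht
  obtain ⟨p, hp⟩ := ht'
  rw [e, ← circ_realVec] at hp
  have hmem : p ∈ circ (word l v) ∩ circ realVec := hp ▸ rfl
  have hip : ip (word l v) realVec = -1 := by
    rcases F.mirrorSystem.word_eq_or_ip_le hv F.realVec_mem hl hc with h | h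
    · rw [h, Set.inter_self] at hp
      exact absurd hp (F.circ_ne_singleton _ F.realVec_mem p)
    · have := sq_ip_le_one_of_mem hunit (F.ip_self_of_mem _ F.realVec_mem) hmem.1 hmem.2
      nlinarith
  obtain ⟨m, hm, em⟩ := F.mirrorSystem.exists_word_orthogonal F.realVec_mem hv hl hc hip
  have hm' : ∀ D ∈ m, D ∈ F.realMirrors := hm
  obtain ⟨g', hg', e'⟩ := exists_mem_Gamma₀ hm'
  refine ⟨m, hm', v, hv, by rw [e, em], ?_, ?_⟩
  · rw [← em] at hip
    rwa [ip_word_realVec hm'] at hip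
  · rw [← tangent_smul_iff hg', e', em, ← e]
    exact ht

/-! ### Adjacent tangencies are not separated by a mirror -/

/-- Curvatures do not decrease along the orbit. -/
lemma le_curvature_word {v : CircleVec} (hv : v ∈ F.vecs) {l : List CircleVec}
    (hl : ∀ D ∈ l, D ∈ F.realMirrors) : v 0 ≤ word l v 0 := by
  obtain ⟨m, hm, hc, hw⟩ := exists_reduced_word (ip_self_of_mem_realMirrors hl)
  have := F.mirrorSystem.ip_word_le hv (k := ptInfty)
    (fun D ⟨_, _, _, _, h⟩ => h.ip_ptInfty_nonpos) (fun D hD => (hl D (hm D hD)).1) hc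
  rw [hw, ip_ptInfty, ip_ptInfty] at this
  linarith

lemma word_eq_or_ip_word_le {v k : CircleVec} (hv : v ∈ F.vecs) (hk : k ∈ F.vecs)
    {l m : List CircleVec} (hl : ∀ D ∈ l, D ∈ F.realMirrors) (hm : ∀ D ∈ m, D ∈ F.realMirrors) :
    word l v = word m k ∨ ip (word l v) (word m k) ≤ -1 := by
  have hm' : ∀ D ∈ m.reverse, D ∈ F.realMirrors := fun D hD => hm D (List.mem_reverse.mp hD)
  have hml : ∀ D ∈ m.reverse ++ l, D ∈ F.realMirrors :=
    fun D hD => (List.mem_append.mp hD).elim (hm' D) (hl D)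
  have back : ∀ x, word m (word m.reverse x) = x := fun x => by
    have := word_reverse_word (ip_self_of_mem_realMirrors hm') x
    rwa [List.reverse_reverse] at this
  obtain ⟨n, hn, hc, hw⟩ := exists_reduced_word (ip_self_of_mem_realMirrors hml)
  have e : word l v = word m (word n v) := by rw [hw, word_append, back]
  rcases F.mirrorSystem.word_eq_or_ip_le hv hk (fun D hD => (hml D (hn D hD)).1) hc with h | h
  · left; rw [e, h]
  · right; rwa [e, ip_word_word (ip_self_of_mem_realMirrors hm)]

/-- A circle touching the real axis has at least the curvature of the two circles at the ends of a
mirror, if it touches inside the mirror. The hypothesis `hside` says this whichever way `D` is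
oriented, and holds on both sides if the mirror is a line. -/
lemma curvature_add_le {D A B w : CircleVec} (h : IsDual D A B realVec) (hA : 0 ≤ A 0)
    (hB : 0 ≤ B 0) (wA : ip w A ≤ -1) (wB : ip w B ≤ -1) (wr : ip w realVec = -1)
    (hside : 0 ≤ ip w D * D 0) : A 0 + B 0 ≤ w 0 := by
  have := h.ip_eq w ptInfty
  rw [ip_comm ptInfty D, ip_comm ptInfty A, ip_comm ptInfty B, ip_comm ptInfty realVec,
    ip_ptInfty, ip_ptInfty, ip_ptInfty, ip_ptInfty, ip_ptInfty, wr] at this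
  have r0 : realVec 0 = 0 := rfl
  rw [r0] at this
  nlinarith [mul_nonneg hA (show 0 ≤ -1 - ip w B by linarith),
    mul_nonneg hB (show 0 ≤ -1 - ip w A by linarith)]

/-- A mirror orthogonal to the real axis meets it only at the points of contact of the two circles
at its ends. -/
lemma mem_circ_of_ip_eq_zero {D A B : CircleVec} (h : IsDual D A B realVec) {x : ℝ}
    (hx : ip D (pt (x : ℂ)) = 0) :
    (((x : ℝ) : ℂ) : RSphere) ∈ circ A ∨ (((x : ℝ) : ℂ) : RSphere) ∈ circ B := by
  have := h.ip_eq (pt (x : ℂ)) (pt (x : ℂ))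
  rw [ip_pt_pt, ip_comm _ D, hx, ip_comm _ realVec, ip_realVec_pt, Complex.ofReal_im] at this
  have h0 : ip (pt (x : ℂ)) A * ip (pt (x : ℂ)) B = 0 := by linarith
  rcases mul_eq_zero.mp h0 with h0 | h0
  · left; rwa [mem_circ, lift_coe, ip_comm]
  · right; rwa [mem_circ, lift_coe, ip_comm]

lemma touchesAt_of_mem {T x : ℝ} {l : List CircleVec} (hl : ∀ D ∈ l, D ∈ F.realMirrors)
    {k : CircleVec} (hk : k ∈ F.vecs) (ht : Tangent (circ k) realLine) (hT : word l k 0 ≤ T)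
    (hx : (((x : ℝ) : ℂ) : RSphere) ∈ circ (word l k)) : F.TouchesAt T x (circ (word l k)) := by
  obtain ⟨g, hg, e⟩ := exists_mem_Gamma₀ hl
  have hp := smul_mem_packing₀ hg hk ht
  rw [e] at hp
  obtain ⟨p, hp'⟩ := hp.2
  have huniq : ∀ q, q ∈ circ (word l k) → q ∈ realLine → q = p := fun q h1 h2 => by
    have : q ∈ circ (word l k) ∩ realLine := ⟨h1, h2⟩
    rwa [hp'] at this
  have hxp := huniq _ hx (coe_mem_realLine x)
  have hunit := ip_word_word (ip_self_of_mem_realMirrors hl) k k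
  rw [F.ip_self_of_mem k hk] at hunit
  have h0 : 0 ≤ word l k 0 := (F.curvature_nonneg k hk).trans (le_curvature_word hk hl)
  -- a line would touch the real axis at `∞`
  have h0' : word l k 0 ≠ 0 := by
    intro h0
    have := huniq OnePoint.infty (by rw [mem_circ, lift_infty, ip_ptInfty, h0]; simp)
      (by rw [← circ_realVec, mem_circ, lift_infty, ip_ptInfty]; simp [realVec])
    rw [← hxp] at this
    exact OnePoint.infty_ne_coe _ this
  exact ⟨hp, by rw [hp', hxp], _, hasCurvature_circ hunit (h0.lt_of_ne h0'.symm), hT⟩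

/-- An image of a mirror that separates two circles touching the real axis at `α₁`, `α₂` ends at
circles of no larger curvature than one of them, and one of its ends lies between `α₁` and
`α₂`. -/
lemma not_separated {T α₁ α₂ : ℝ} (hadj : AdjacentIn (F.tangencies T) α₁ α₂)
    {v₁ v₂ : CircleVec} (hv₁ : v₁ ∈ F.vecs) (hv₂ : v₂ ∈ F.vecs)
    (hr₁ : ip v₁ realVec = -1) (hr₂ : ip v₂ realVec = -1) {l₁ l₂ m : List CircleVec}
    (hl₁ : ∀ D ∈ l₁, D ∈ F.realMirrors) (hl₂ : ∀ D ∈ l₂, D ∈ F.realMirrors)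
    (hm : ∀ D ∈ m, D ∈ F.realMirrors)
    (hT₁ : word l₁ v₁ 0 ≤ T) (hT₂ : word l₂ v₂ 0 ≤ T)
    (hα₁ : (((α₁ : ℝ) : ℂ) : RSphere) ∈ circ (word l₁ v₁))
    (hα₂ : (((α₂ : ℝ) : ℂ) : RSphere) ∈ circ (word l₂ v₂))
    {D : CircleVec} (hD : D ∈ F.realMirrors) (hneg : ip (word l₁ v₁) (word m D) < 0)
    (hpos : 0 < ip (word l₂ v₂) (word m D)) : False := by
  obtain ⟨⟨A, B, C, S, hmir⟩, h0⟩ := hD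
  obtain ⟨X, Y, hmir⟩ := hmir.exists_of_ip_eq_zero F.realVec_mem h0
  have um := ip_self_of_mem_realMirrors hm
  have hword := ip_word_word um
  have hreal := word_realVec hm
  have dual : IsDual (word m D) (word m X) (word m Y) realVec := by
    have d := hmir.dual
    rw [← hreal]
    exact ⟨by rw [hword, d.aa], by rw [hword, d.bb], by rw [hword, d.cc], by rw [hword, d.ab],
      by rw [hword, d.bc], by rw [hword, d.ac], by rw [hword, d.dd], by rw [hword, d.da],
      by rw [hword, d.db], by rw [hword, d.dc]⟩
  have tX : Tangent (circ X) realLine := by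
    rw [← circ_realVec]; exact hmir.rotate.rotate.tangent.symm
  have tY : Tangent (circ Y) realLine := by
    rw [← circ_realVec]; exact hmir.rotate.tangent
  have cX : 0 ≤ word m X 0 := (F.curvature_nonneg X hmir.memA).trans
    (le_curvature_word hmir.memA hm)
  have cY : 0 ≤ word m Y 0 := (F.curvature_nonneg Y hmir.memB).trans
    (le_curvature_word hmir.memB hm)
  -- both ends of the mirror have curvature at most `T`
  have bound : ∀ {v : CircleVec} {l : List CircleVec}, v ∈ F.vecs →
      (∀ D ∈ l, D ∈ F.realMirrors) → ip v realVec = -1 → word l v 0 ≤ T →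
      ip (word l v) (word m D) ≠ 0 → 0 ≤ ip (word l v) (word m D) * word m D 0 →
      word m X 0 ≤ T ∧ word m Y 0 ≤ T := by
    intro v l hv hl hr hT hne hs
    have sep : ∀ k ∈ F.vecs, ip D k = 0 → ip (word l v) (word m k) ≤ -1 := by
      intro k hk hDk
      rcases word_eq_or_ip_word_le hv hk hl hm with e | e
      · rw [e, hword, ip_comm, hDk] at hne
        exact absurd rfl hne
      · exact e
    have := curvature_add_le dual cX cY (sep X hmir.memA hmir.dual.da)
      (sep Y hmir.memB hmir.dual.db) ((ip_word_realVec hl v).trans hr) hs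
    constructor <;> linarith
  have hXY : word m X 0 ≤ T ∧ word m Y 0 ≤ T := by
    rcases le_total 0 (word m D 0) with hc | hc
    · exact bound hv₂ hl₂ hr₂ hT₂ hpos.ne' (mul_nonneg hpos.le hc)
    · exact bound hv₁ hl₁ hr₁ hT₁ hneg.ne (mul_nonneg_of_nonpos_of_nonpos hneg.le hc)
  -- the points of contact lie on different sides of the mirror
  have foot : ∀ {v : CircleVec} {l : List CircleVec} {α : ℝ}, v ∈ F.vecs →
      (∀ D ∈ l, D ∈ F.realMirrors) → ip v realVec = -1 →
      (((α : ℝ) : ℂ) : RSphere) ∈ circ (word l v) →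
      0 ≤ word l v 0 ∧ ip (word l v) (word m D) = word l v 0 * ip (word m D) (pt (α : ℂ)) := by
    intro v l α hv hl hr hα
    refine ⟨(F.curvature_nonneg v hv).trans (le_curvature_word hv hl), ?_⟩
    have hunit := ip_word_word (ip_self_of_mem_realMirrors hl) v v
    rw [F.ip_self_of_mem v hv] at hunit
    have e := congrArg (fun w => ip w (word m D))
      (add_realVec_eq hunit ((ip_word_realVec hl v).trans hr) hα)
    simp only [ip_add_left, ip_smul_left] at e
    rw [ip_comm realVec, dual.dc, add_zero, ip_comm (pt _)] at e
    exact e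
  obtain ⟨k₁, e₁⟩ := foot hv₁ hl₁ hr₁ hα₁
  obtain ⟨k₂, e₂⟩ := foot hv₂ hl₂ hr₂ hα₂
  rw [e₁] at hneg
  rw [e₂] at hpos
  have f₁ : ip (word m D) (pt (α₁ : ℂ)) < 0 := by
    by_contra! h; exact absurd hneg (not_lt.mpr (mul_nonneg k₁ h))
  have f₂ : 0 < ip (word m D) (pt (α₂ : ℂ)) := pos_of_mul_pos_right hpos k₂
  have cont : Continuous fun x : ℝ => ip (word m D) (pt (x : ℂ)) :=
    (continuous_ip_pt _).comp Complex.continuous_ofReal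
  obtain ⟨x, hlt, hgt, hx⟩ : ∃ x : ℝ, min α₁ α₂ < x ∧ x < max α₁ α₂ ∧
      ip (word m D) (pt (x : ℂ)) = 0 := by
    rcases hadj.2.2.1.lt_or_gt with h | h
    · obtain ⟨x, hx, e⟩ := intermediate_value_Ioo h.le cont.continuousOn ⟨f₁, f₂⟩
      exact ⟨x, by rw [min_eq_left h.le]; exact hx.1, by rw [max_eq_right h.le]; exact hx.2, e⟩
    · obtain ⟨x, hx, e⟩ := intermediate_value_Ioo' h.le cont.continuousOn ⟨f₁, f₂⟩
      exact ⟨x, by rw [min_eq_right h.le]; exact hx.1, by rw [max_eq_left h.le]; exact hx.2, e⟩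
  rcases mem_circ_of_ip_eq_zero dual hx with hmem | hmem
  · exact hadj.2.2.2 x ⟨_, touchesAt_of_mem hm hmir.memA tX hXY.1 hmem⟩ ⟨hlt, hgt⟩
  · exact hadj.2.2.2 x ⟨_, touchesAt_of_mem hm hmir.memB tY hXY.2 hmem⟩ ⟨hlt, hgt⟩

/-! ### Uniqueness of the carrying element -/

/-- An element of the stabilizer of the real axis that carries initial circles to two different
initial circles, neither of them the real axis, is trivial or the reflection in the dual circle of
the gap that these bound with the real axis. -/
lemma eq_one_or_mirror {g : Equiv.Perm RSphere} (hg : g ∈ F.Gamma₀) {a₁ a₂ v₁ v₂ : CircleVec}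
    (ha₁ : a₁ ∈ F.vecs) (ha₂ : a₂ ∈ F.vecs) (hv₁ : v₁ ∈ F.vecs) (hv₂ : v₂ ∈ F.vecs)
    (hne : v₁ ≠ v₂) (hr₁ : v₁ ≠ realVec) (hr₂ : v₂ ≠ realVec)
    (h₁ : g • circ a₁ = circ v₁) (h₂ : g • circ a₂ = circ v₂) :
    g = 1 ∨ ∃ D, F.IsMirrorOf D v₁ v₂ realVec g := by
  obtain ⟨hgr, hreal⟩ := mem_Gamma₀_iff.mp hg
  obtain ⟨l, hl, hc, e⟩ := F.exists_word hgr
  have fix : ∀ a ∈ F.vecs, ∀ v ∈ F.vecs, g • circ a = circ v → ∀ D ∈ l, ip v D = 0 := by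
    intro a ha v hv h
    have hunit := ip_word_word (fun D hD => F.mirrorSystem.mirror_self D (hl D hD)) a a
    rw [F.ip_self_of_mem a ha] at hunit
    have e' : circ (word l a) = circ v := by rw [← e, h]
    have hfix := F.mirrorSystem.fixes_of_word_eq F.exists_third ha hv hl hc
      (eq_or_eq_neg_of_circ_eq hunit (F.ip_self_of_mem v hv) e')
    rw [word_eq_self hfix] at e'
    rwa [← F.circ_injOn ha hv e']
  have f₁ := fix a₁ ha₁ v₁ hv₁ h₁
  have f₂ := fix a₂ ha₂ v₂ hv₂ h₂
  have f₀ := fix realVec F.realVec_mem realVec F.realVec_mem (by rw [circ_realVec, hreal])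
  have mirror : ∀ D ∈ l, ∃ S, F.IsMirrorOf D v₁ v₂ realVec S := by
    intro D hD
    obtain ⟨A, B, C, S, h⟩ := hl D hD
    exact ⟨S, h.of_ip_eq_zero hv₁ hv₂ F.realVec_mem hne hr₁ hr₂ (f₁ D hD) (f₂ D hD) (f₀ D hD)⟩
  rcases l with _ | ⟨D, _ | ⟨D', l⟩⟩
  · left
    exact eq_one_of_smul_circ fun v _ => by rw [e, word_nil]
  · right
    obtain ⟨S, hS⟩ := mirror D (by simp)
    have : g = S := eq_of_smul_circ_eq fun v => by rw [e, hS.smul_circ, word_cons, word_nil]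
    exact ⟨D, this ▸ hS⟩
  · exfalso
    obtain ⟨S, hS⟩ := mirror D (by simp)
    obtain ⟨S', hS'⟩ := mirror D' (by simp)
    exact (List.isChain_cons_cons.mp hc).1 (hS'.eq_of_isDual hS hS'.dual hS.dual)

lemma IsMirrorOf.ne_one {D A B C : CircleVec} {S : Equiv.Perm RSphere}
    (h : F.IsMirrorOf D A B C S) : S ≠ 1 := by
  rintro rfl
  obtain ⟨k, hk, hne⟩ := exists_ip_ne_zero (F := F) h.dual.dd
  have e := h.smul_circ k
  rw [one_smul] at e
  have hu := ip_refl_refl h.dual.dd k k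
  rw [F.ip_self_of_mem k hk] at hu
  exact hne (F.mirrorSystem.fixes_of_word_eq F.exists_third hk hk (l := [D])
    (by simpa using h.mem_mirrors) (by simp)
    (eq_or_eq_neg_of_circ_eq hu (F.ip_self_of_mem k hk) e.symm) D (by simp))

lemma IsMirrorOf.reflection_unique {D D' A B C : CircleVec} {S S' : Equiv.Perm RSphere}
    (h : F.IsMirrorOf D A B C S) (h' : F.IsMirrorOf D' A B C S') : S = S' := by
  have e := h.eq_of_isDual h' h.dual h'.dual
  subst e
  exact eq_of_smul_circ_eq fun v => by rw [h.smul_circ, h'.smul_circ]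

end FordConfiguration
end FordPacking

end

/-! ### Circles at adjacent tangencies -/

open FordPacking FordPacking.FordConfiguration in
theorem mainTheorem6 (F : FordPacking.FordConfiguration) (T : ℝ) (α₁ α₂ : ℝ)
    (hadj : FordPacking.AdjacentIn (F.tangencies T) α₁ α₂)
    (C₁ C₂ : Set FordPacking.RSphere)
    (hC₁ : F.TouchesAt T α₁ C₁) (hC₂ : F.TouchesAt T α₂ C₂) :
    ∃ γ ∈ F.Gamma₀, ∃ Ci ∈ F.initial₀, ∃ Cj ∈ F.initial₀,
      γ • Ci = C₁ ∧ γ • Cj = C₂ ∧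
      (Disjoint C₁ C₂ → F.carriers C₁ C₂ = {γ}) ∧
      (FordPacking.Tangent C₁ C₂ →
        (∀ S, F.IsGapReflection Ci Cj FordPacking.realLine S →
          S ∈ F.gapReflections ∧ γ * S ≠ γ ∧ F.carriers C₁ C₂ = {γ, γ * S}) ∧
        ((¬ ∃ S, F.IsGapReflection Ci Cj FordPacking.realLine S) →
          F.carriers C₁ C₂ = {γ})) := by
  obtain ⟨hp₁, hi₁, κ₁, hκ₁, hT₁⟩ := hC₁
  obtain ⟨hp₂, hi₂, κ₂, hκ₂, hT₂⟩ := hC₂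
  obtain ⟨l₁, hl₁, v₁, hv₁, rfl, hr₁, ht₁⟩ := exists_word_of_mem_packing₀ hp₁
  obtain ⟨l₂, hl₂, v₂, hv₂, rfl, hr₂, ht₂⟩ := exists_word_of_mem_packing₀ hp₂
  have u₁ := ip_self_of_mem_realMirrors hl₁
  have hα₁ : (((α₁ : ℝ) : ℂ) : RSphere) ∈ circ (word l₁ v₁) := by
    have : (((α₁ : ℝ) : ℂ) : RSphere) ∈ circ (word l₁ v₁) ∩ realLine := hi₁ ▸ rfl
    exact this.1
  have hα₂ : (((α₂ : ℝ) : ℂ) : RSphere) ∈ circ (word l₂ v₂) := by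
    have : (((α₂ : ℝ) : ℂ) : RSphere) ∈ circ (word l₂ v₂) ∩ realLine := hi₂ ▸ rfl
    exact this.1
  have curv : ∀ {l : List CircleVec} {v : CircleVec} {κ : ℝ}, (∀ D ∈ l, D ∈ F.realMirrors) →
      v ∈ F.vecs → HasCurvature (circ (word l v)) κ → κ ≤ T → word l v 0 ≤ T := by
    intro l v κ hl hv hκ hT
    have hunit := ip_word_word (ip_self_of_mem_realMirrors hl) v v
    rw [F.ip_self_of_mem v hv] at hunit
    exact (le_abs_self _).trans (hκ.eq_abs hunit ▸ hT)
  -- the relative position of the two circles, as a reduced word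
  have hrev : ∀ D ∈ l₁.reverse, D ∈ F.realMirrors := fun D hD => hl₁ D (List.mem_reverse.mp hD)
  have hrl : ∀ D ∈ l₁.reverse ++ l₂, D ∈ F.realMirrors :=
    fun D hD => (List.mem_append.mp hD).elim (hrev D) (hl₂ D)
  obtain ⟨n, hn, hnc, hnw⟩ := exists_reduced_word (ip_self_of_mem_realMirrors hrl)
  have back : word l₁ (word n v₂) = word l₂ v₂ := by
    have := word_reverse_word (ip_self_of_mem_realMirrors hrev) (word l₂ v₂)
    rwa [List.reverse_reverse, ← word_append l₁.reverse, ← hnw] at this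
  obtain ⟨m, hm, em₁, em₂⟩ : ∃ m : List CircleVec, (∀ D ∈ m, D ∈ F.realMirrors) ∧
      word m v₁ = v₁ ∧ word m v₂ = word n v₂ := by
    rcases F.mirrorSystem.common_image_or_separated hv₁ hv₂ (N := F.realMirrors)
      (fun _ h => h.1) (fun D hD => hrl D (hn D hD)) hnc with h | ⟨m, hm, D, hD, hneg, hpos⟩
    · exact h
    · exfalso
      refine not_separated hadj hv₁ hv₂ hr₁ hr₂ hl₁ hl₂ (m := l₁ ++ m)
        (fun D hD => (List.mem_append.mp hD).elim (hl₁ D) (hm D)) (curv hl₁ hv₁ hκ₁ hT₁)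
        (curv hl₂ hv₂ hκ₂ hT₂) hα₁ hα₂ hD ?_ ?_
      · rwa [word_append, ip_word_word u₁]
      · rwa [word_append, ← back, ip_word_word u₁]
  obtain ⟨γ, hγ, eγ⟩ := exists_mem_Gamma₀ (F := F) (l := l₁ ++ m)
    (fun D hD => (List.mem_append.mp hD).elim (hl₁ D) (hm D))
  have g₁ : γ • circ v₁ = circ (word l₁ v₁) := by rw [eγ, word_append, em₁]
  have g₂ : γ • circ v₂ = circ (word l₂ v₂) := by rw [eγ, word_append, em₂, back]
  have k₁ := circ_mem_initial₀ hv₁ ht₁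
  have k₂ := circ_mem_initial₀ hv₂ ht₂
  have hne : v₁ ≠ v₂ := by
    rintro rfl
    rw [g₁] at g₂
    rw [g₂, hi₂] at hi₁
    have := Set.singleton_injective hi₁
    rw [OnePoint.coe_eq_coe, Complex.ofReal_inj] at this
    exact hadj.2.2.1 this.symm
  have notreal : ∀ v : CircleVec, ip v realVec = -1 → v ≠ realVec := by
    rintro v h rfl
    rw [F.ip_self_of_mem _ F.realVec_mem] at h
    linarith
  have hself : γ ∈ F.carriers (circ (word l₁ v₁)) (circ (word l₂ v₂)) :=
    ⟨hγ, _, k₁, _, k₂, g₁, g₂⟩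
  have carrier : ∀ γ' ∈ F.carriers (circ (word l₁ v₁)) (circ (word l₂ v₂)),
      γ' = γ ∨ ∃ D, F.IsMirrorOf D v₁ v₂ realVec (γ⁻¹ * γ') := by
    rintro γ' ⟨hγ', A, hA, B, hB, eA, eB⟩
    obtain ⟨a, ha, rfl⟩ := F.exists_vec_of_mem_initial hA.1
    obtain ⟨b, hb, rfl⟩ := F.exists_vec_of_mem_initial hB.1
    rcases eq_one_or_mirror (mul_mem (inv_mem hγ) hγ') ha hb hv₁ hv₂ hne (notreal _ hr₁)
      (notreal _ hr₂) (by rw [mul_smul, eA, ← g₁, inv_smul_smul])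
      (by rw [mul_smul, eB, ← g₂, inv_smul_smul]) with h | h
    · left; exact (inv_mul_eq_one.mp h).symm
    · right; exact h
  -- without a gap reflection that fixes both circles, `γ` is the only carrying element
  have single : (∀ D S, ¬ F.IsMirrorOf D v₁ v₂ realVec S) →
      F.carriers (circ (word l₁ v₁)) (circ (word l₂ v₂)) = {γ} := by
    intro h
    refine Set.eq_singleton_iff_unique_mem.mpr ⟨hself, fun γ' hγ' => ?_⟩
    rcases carrier γ' hγ' with e | ⟨D, hD⟩
    · exact e
    · exact absurd hD (h D _)
  refine ⟨γ, hγ, _, k₁, _, k₂, g₁, g₂, ?_, fun _ => ⟨?_, ?_⟩⟩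
  · intro hdis
    refine single fun D S hD => ?_
    obtain ⟨p, hp⟩ := hD.tangent.smul γ
    rw [g₁, g₂, Set.disjoint_iff_inter_eq_empty.mp hdis] at hp
    exact Set.singleton_ne_empty p hp.symm
  · intro S hS
    obtain ⟨D, A, B, C, hD, eA, eB, eC⟩ := hS.exists_mirror
    rw [← circ_realVec] at eC
    obtain rfl := F.circ_injOn hv₁ hD.memA eA
    obtain rfl := F.circ_injOn hv₂ hD.memB eB
    obtain rfl := F.circ_injOn F.realVec_mem hD.memC eC
    have hS₀ : S ∈ F.Gamma₀ := mem_Gamma₀_iff.mpr ⟨hD.mem_reflectionGroup, by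
      rw [← circ_realVec, hD.smul_circ, refl_eq_self (by rw [ip_comm, hD.dual.dc])]⟩
    have s₁ : S • circ v₁ = circ v₁ := by
      rw [hD.smul_circ, refl_eq_self (by rw [ip_comm, hD.dual.da])]
    have s₂ : S • circ v₂ = circ v₂ := by
      rw [hD.smul_circ, refl_eq_self (by rw [ip_comm, hD.dual.db])]
    refine ⟨⟨_, _, _, hS⟩, fun e => hD.ne_one (mul_eq_left.mp e), ?_⟩
    ext γ'
    rw [Set.mem_insert_iff, Set.mem_singleton_iff]
    constructor
    · intro hγ'
      rcases carrier γ' hγ' with e | ⟨D', hD'⟩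
      · exact Or.inl e
      · right
        rw [hD.reflection_unique hD', mul_inv_cancel_left]
    · rintro (rfl | rfl)
      · exact hself
      · exact ⟨mul_mem hγ hS₀, _, k₁, _, k₂, by rw [mul_smul, s₁, g₁], by rw [mul_smul, s₂, g₂]⟩
  · intro h
    refine single fun D S hD => h ⟨S, ?_⟩
    rw [← circ_realVec]
    exact hD.gap
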